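/- Let $G$ be a (finite-dimensional) Lie group with Lie algebra $\mathfrak g$, let $S^1=\mathbb R/2\pi\mathbb Z$, let $\Omega G$ be the group of smooth maps $\gamma\colon S^1\to G$ with $\gamma(0)=1$, and let $\Omega\mathfrak g$ be its Lie algebra, the smooth maps $S^1\to\mathfrak g$ that vanish at $0$. Let $\pi\colon P\to M$ be a smooth principal $\Omega G$-bundle over a (possibly infinite-dimensional) manifold $M$, all smooth structures being understood as diffeologies, with an ($\Omega\mathfrak g$-valued) connection form $A$ and a Higgs field $\Phi$, i.e. a smooth map $\Phi\colon P\to C^\infty(S^1,\mathfrak g)$ with $\Phi(p\gamma)=\mathrm{Ad}(\gamma^{-1})\Phi(p)+\gamma^{-1}\partial\gamma$ for $p\in P$, $\gamma\in\Omega G$. Its caloron transform is the principal $G$-bundle $\widetilde P=(P\times G\times S^1)/\Omega G\to M\times S^1$, where $(p,g,\theta)\gamma=(p\gamma,\gamma(\theta)^{-1}g,\theta)$, $[p,g,\theta]h=[p,gh,\theta]$ and $[p,g,\theta]\mapsto(\pi(p),\theta)$, with the framing $s_0(m,0)=[p,1,0]$ ($p$ any point of $P$ over $m$) over $M\times\{0\}$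 and with the connection induced by $\tilde A=\mathrm{Ad}(g^{-1})A(\theta)+\Theta+\mathrm{Ad}(g^{-1})\Phi\,d\theta$, where $\Theta$ is the Maurer-Cartan form of $G$. Let $\eta(m)$ be the loop $\theta\mapsto(m,\theta)$ in $M\times S^1$ and $\hat\eta(p)$ the loop $\theta\mapsto[p,1,\theta]$ in $\widetilde P$. (a) For every $p\in P$ there is a unique smooth path $g\colon\mathbb R\to G$ with $g(0)=1$, $g^{-1}\partial g$ periodic with period $2\pi$, and $g^{-1}\partial g=\Phi(p)$. Denote it by $\mathrm{hol}_\Phi(p)$. The value $\mathrm{hol}_\Phi(p)(2\pi)$ depends only on $m=\pi(p)$; this defines the Higgs field holonomy $\mathrm{hol}_\Phi\colon M\to G$. (b) For every $m\in M$ the loop $\eta(m)$ has a unique $\tilde A$-horizontal lift $\eta(m)_h\colon\mathbb R\to\widetilde P$ with $\eta(m)_h(0)=s_0(m,0)$. Its holonomy relative to the framing is the element $\mathrm{hol}(\eta(m))\in G$ with $s_0(m,0)=\eta(m)_h(2\pi)\,\mathrm{hol}(\eta(m))$, and the holonomy of $\hat\eta(p)$, for $\pi(p)=m$, is the path $\mathrm{hol}(\hat\eta(p))\colon\mathbb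 R\to G$ with $\hat\eta(p)(t)=\eta(m)_h(t)\,\mathrm{hol}(\hat\eta(p))(t)$. (c) $\mathrm{hol}_\Phi(p)=\mathrm{hol}(\hat\eta(p))$ for every $p\in P$, and $\mathrm{hol}_\Phi=\mathrm{hol}\circ\eta$ as maps $M\to G$. -/

import Mathlib

open scoped Manifold ContDiff Topology
open Diffeology

noncomputable section

namespace Caloron

/-- The Euclidean space `ℝⁿ`. -/
abbrev Eu (n : ℕ) : Type := EuclideanSpace ℝ (Fin n)

/-! ### Calculus on a Lie group

`G` is a Lie group of dimension `d`; its Lie algebra `𝔤 = T₁G` is, in Mathlib, the model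
space `Eu d`. -/

section LieCalculus

variable {d : ℕ} {G : Type*} [TopologicalSpace G] [ChartedSpace (Eu d) G]
variable {W : Type*} [NormedAddCommGroup W] [NormedSpace ℝ W]

/-- The derivative `T_w W → T_{u(w)} G` of `u : W → G` at `w`, tangent spaces of `G` being
(as always in Mathlib) the model space. -/
def mder (d : ℕ) {G : Type*} [TopologicalSpace G] [ChartedSpace (Eu d) G]
    {W : Type*} [NormedAddCommGroup W] [NormedSpace ℝ W] (u : W → G) (w : W) : W →L[ℝ] Eu d :=
  mfderiv 𝓘(ℝ, W) (𝓡 d) u w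

theorem mder_const (c : G) (w : W) : mder d (fun _ : W => c) w = 0 := mfderiv_const

theorem mder_congr {g h : W → G} {w : W} (e : g =ᶠ[𝓝 w] h) : mder d g w = mder d h w :=
  e.mfderiv_eq

variable [Group G]

/-- The logarithmic derivative `g⁻¹ dg : T_w W → 𝔤` of `g : W → G` at `w`. -/
def logDer (d : ℕ) {G : Type*} [TopologicalSpace G] [ChartedSpace (Eu d) G] [Group G]
    {W : Type*} [NormedAddCommGroup W] [NormedSpace ℝ W] (g : W → G) (w : W) : W →L[ℝ] Eu d :=
  mder d (fun y => (g w)⁻¹ * g y) w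

/-- The adjoint action of `c : G` on `𝔤 = T₁G`: the derivative at `1` of `x ↦ c x c⁻¹`. -/
def Ad (d : ℕ) {G : Type*} [TopologicalSpace G] [ChartedSpace (Eu d) G] [Group G] (c : G) :
    Eu d →L[ℝ] Eu d :=
  mfderiv (𝓡 d) (𝓡 d) (fun x : G => c * x * c⁻¹) 1

theorem mder_eq_chart {u : W → G} {w : W} (hu : MDifferentiableAt 𝓘(ℝ, W) (𝓡 d) u w)
    (h1 : u w = 1) :
    mder d u w = fderiv ℝ (fun y => extChartAt (𝓡 d) (1 : G) (u y)) w := by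
  have := hu.mfderiv
  unfold mder
  rw [this]
  have e : writtenInExtChartAt 𝓘(ℝ, W) (𝓡 d) w u
      = fun y => extChartAt (𝓡 d) (1 : G) (u y) := by
    ext1 y
    simp only [writtenInExtChartAt, h1]
    rfl
  rw [e]
  have e2 : Set.range (𝓘(ℝ, W)) = Set.univ := ModelWithCorners.range_eq_univ _
  rw [e2, fderivWithin_univ]
  rfl

theorem logDer_const (c : G) (w : W) : logDer d (fun _ : W => c) w = 0 := mder_const _ _

theorem logDer_congr {g h : W → G} {w : W} (e : g =ᶠ[𝓝 w] h) : logDer d g w = logDer d h w := by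
  unfold logDer
  rw [e.self_of_nhds]
  apply mder_congr
  filter_upwards [e] with y hy using by rw [hy]

variable [LieGroup (𝓡 d) ∞ G]

theorem contMDiffAt_chart_one : ContMDiffAt (𝓡 d) 𝓘(ℝ, Eu d) ∞ (extChartAt (𝓡 d) (1 : G)) 1 := by
  have : IsManifold (𝓡 d) ∞ G := LieGroup.toContMDiffMul.toIsManifold
  exact contMDiffAt_extChartAt

theorem contMDiffAt_inv_mul {g : W → G} {w : W} (hg : ContMDiffAt 𝓘(ℝ, W) (𝓡 d) ∞ g w) (c : G) :
    ContMDiffAt 𝓘(ℝ, W) (𝓡 d) ∞ (fun y => c * g y) w :=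
  contMDiffAt_const.mul hg

theorem logDer_eq_chart {g : W → G} {w : W} (hg : ContMDiffAt 𝓘(ℝ, W) (𝓡 d) ∞ g w) :
    logDer d g w = fderiv ℝ (fun y => extChartAt (𝓡 d) (1 : G) ((g w)⁻¹ * g y)) w :=
  mder_eq_chart ((contMDiffAt_inv_mul hg _).mdifferentiableAt (by simp)) (by simp)

theorem mdiff_conj (c x : G) :
    ContMDiffAt (𝓡 d) (𝓡 d) ∞ (fun x : G => c * x * c⁻¹) x :=
  (contMDiffAt_const.mul contMDiffAt_id).mul contMDiffAt_const

theorem mder_conj {u : W → G} {w : W} (hu : MDifferentiableAt 𝓘(ℝ, W) (𝓡 d) u w)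
    (h1 : u w = 1) (c : G) :
    mder d (fun y => c * u y * c⁻¹) w = (Ad d c).comp (mder d u w) := by
  have := mfderiv_comp (I := 𝓘(ℝ, W)) (I' := 𝓡 d) (I'' := 𝓡 d) w
    (g := fun x : G => c * x * c⁻¹) (f := u) ((mdiff_conj c (u w)).mdifferentiableAt (by simp)) hu
  rw [h1] at this
  exact this

theorem mfderiv_mul_one_one :
    (mfderiv ((𝓡 d).prod (𝓡 d)) (𝓡 d) (fun z : G × G => z.1 * z.2)
      ((1, 1) : G × G) : Eu d × Eu d →L[ℝ] Eu d)
      = ContinuousLinearMap.fst ℝ (Eu d) (Eu d) + ContinuousLinearMap.snd ℝ (Eu d) (Eu d) := by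
  have hm : MDifferentiableAt ((𝓡 d).prod (𝓡 d)) (𝓡 d) (fun z : G × G => z.1 * z.2)
      ((1, 1) : G × G) :=
    (contMDiff_mul (𝓡 d) ∞).mdifferentiable (by simp) _
  have h2 := mfderiv_prod_eq_add_comp (I := 𝓡 d) (I' := 𝓡 d) (I'' := 𝓡 d) hm
  have e1 : (mfderiv (𝓡 d) (𝓡 d) (fun z : G => z * 1) 1 : Eu d →L[ℝ] Eu d)
      = ContinuousLinearMap.id ℝ (Eu d) := by
    have : (fun z : G => z * 1) = id := by ext; simp
    rw [this]; exact mfderiv_id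
  have e2 : (mfderiv (𝓡 d) (𝓡 d) (fun z : G => 1 * z) 1 : Eu d →L[ℝ] Eu d)
      = ContinuousLinearMap.id ℝ (Eu d) := by
    have : (fun z : G => 1 * z) = id := by ext; simp
    rw [this]; exact mfderiv_id
  refine h2.trans ?_
  change ContinuousLinearMap.comp (mfderiv (𝓡 d) (𝓡 d) (fun z : G => z * 1) 1 : Eu d →L[ℝ] Eu d)
    (ContinuousLinearMap.fst ℝ (Eu d) (Eu d)) +
    ContinuousLinearMap.comp (mfderiv (𝓡 d) (𝓡 d) (fun z : G => 1 * z) 1 : Eu d →L[ℝ] Eu d)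
    (ContinuousLinearMap.snd ℝ (Eu d) (Eu d)) = _
  rw [e1, e2]; rfl

theorem mder_mul_one {u v : W → G} {w : W} (hu : MDifferentiableAt 𝓘(ℝ, W) (𝓡 d) u w)
    (hv : MDifferentiableAt 𝓘(ℝ, W) (𝓡 d) v w) (hu1 : u w = 1) (hv1 : v w = 1) :
    mder d (fun y => u y * v y) w = mder d u w + mder d v w := by
  have hc : HasMFDerivAt 𝓘(ℝ, W) ((𝓡 d).prod (𝓡 d)) (fun y => (u y, v y)) w
      ((mfderiv 𝓘(ℝ, W) (𝓡 d) u w).prod (mfderiv 𝓘(ℝ, W) (𝓡 d) v w)) :=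
    hu.hasMFDerivAt.prodMk hv.hasMFDerivAt
  have hm' : MDifferentiableAt ((𝓡 d).prod (𝓡 d)) (𝓡 d) (fun z : G × G => z.1 * z.2)
      ((fun y => (u y, v y)) w) := (contMDiff_mul (𝓡 d) ∞).mdifferentiable (by simp) _
  have h3 := (hm'.hasMFDerivAt.comp w hc).mfderiv
  have h4 : (mfderiv ((𝓡 d).prod (𝓡 d)) (𝓡 d) (fun z : G × G => z.1 * z.2)
      ((fun y => (u y, v y)) w) : Eu d × Eu d →L[ℝ] Eu d)
      = ContinuousLinearMap.fst ℝ (Eu d) (Eu d) + ContinuousLinearMap.snd ℝ (Eu d) (Eu d) := by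
    have hp : (fun y => (u y, v y)) w = ((1, 1) : G × G) := by simp [hu1, hv1]
    rw [hp]
    exact mfderiv_mul_one_one (d := d) (G := G)
  have h5 : mder d (fun y => u y * v y) w = (mfderiv ((𝓡 d).prod (𝓡 d)) (𝓡 d)
      (fun z : G × G => z.1 * z.2)
      ((fun y => (u y, v y)) w) : Eu d × Eu d →L[ℝ] Eu d).comp
      ((mder d u w).prod (mder d v w)) := h3
  rw [h5, h4]
  ext x : 1
  rfl

theorem logDer_mul {g h : W → G} {w : W} (hg : ContMDiffAt 𝓘(ℝ, W) (𝓡 d) ∞ g w)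
    (hh : ContMDiffAt 𝓘(ℝ, W) (𝓡 d) ∞ h w) :
    logDer d (fun y => g y * h y) w = (Ad d (h w)⁻¹).comp (logDer d g w) + logDer d h w := by
  have hg' := (contMDiffAt_inv_mul hg (g w)⁻¹).mdifferentiableAt (by simp)
  have hh' := (contMDiffAt_inv_mul hh (h w)⁻¹).mdifferentiableAt (by simp)
  have hgc : MDifferentiableAt 𝓘(ℝ, W) (𝓡 d)
      (fun y => (h w)⁻¹ * ((g w)⁻¹ * g y) * ((h w)⁻¹)⁻¹) w :=
    ((contMDiffAt_const.mul (contMDiffAt_inv_mul hg (g w)⁻¹)).mul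
      contMDiffAt_const).mdifferentiableAt (by simp)
  have := mder_mul_one hgc hh' (by simp) (by simp)
  rw [mder_conj hg' (by simp)] at this
  unfold logDer
  rw [← this]
  have e : (fun y => (g w * h w)⁻¹ * (g y * h y)) =
    (fun y => (h w)⁻¹ * ((g w)⁻¹ * g y) * (h w)⁻¹⁻¹ * ((h w)⁻¹ * h y)) := by
    ext y; simp [mul_assoc]
  simp only [e]

theorem logDer_comp {V : Type*} [NormedAddCommGroup V] [NormedSpace ℝ V] {g : W → G} {f : V → W}
    {x : V} (hg : ContMDiffAt 𝓘(ℝ, W) (𝓡 d) ∞ g (f x)) (hf : DifferentiableAt ℝ f x) (v : V) :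
    logDer d (g ∘ f) x v = logDer d g (f x) (fderiv ℝ f x v) := by
  have h := (contMDiffAt_inv_mul hg (g (f x))⁻¹).mdifferentiableAt (show (∞ : WithTop ℕ∞) ≠ 0 by simp)
  have := mfderiv_comp (I := 𝓘(ℝ, V)) (I' := 𝓘(ℝ, W)) (I'' := 𝓡 d) x h hf.mdifferentiableAt
  rw [mfderiv_eq_fderiv] at this
  exact congrArg (fun L : V →L[ℝ] Eu d => L v) this

/-- `T₁`-coordinates around `1`. -/
theorem chart_symm_smooth :
    ContMDiffAt 𝓘(ℝ, Eu d) (𝓡 d) ∞ (extChartAt (𝓡 d) (1 : G)).symm (extChartAt (𝓡 d) (1 : G) 1) := by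
  have : IsManifold (𝓡 d) ∞ G := LieGroup.toContMDiffMul.toIsManifold
  exact (contMDiffOn_extChartAt_symm (1 : G)).contMDiffAt
    (extChartAt_target_mem_nhds (I := 𝓡 d) (1 : G))

theorem mder_chart_symm :
    mder d (extChartAt (𝓡 d) (1 : G)).symm (extChartAt (𝓡 d) (1 : G) 1)
      = ContinuousLinearMap.id ℝ (Eu d) := by
  rw [mder_eq_chart (chart_symm_smooth.mdifferentiableAt (by simp)) (extChartAt_to_inv (1 : G))]
  have : (fun y => extChartAt (𝓡 d) (1 : G) ((extChartAt (𝓡 d) (1 : G)).symm y))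
      =ᶠ[𝓝 (extChartAt (𝓡 d) (1 : G) 1)] id := by
    filter_upwards [extChartAt_target_mem_nhds (I := 𝓡 d) (1 : G)] with y hy
    exact (extChartAt (𝓡 d) (1 : G)).right_inv hy
  rw [this.fderiv_eq, fderiv_id]

theorem Ad_eq_chart (c : G) :
    Ad d c = fderiv ℝ (fun z => extChartAt (𝓡 d) (1 : G)
      (c * (extChartAt (𝓡 d) (1 : G)).symm z * c⁻¹)) (extChartAt (𝓡 d) (1 : G) 1) := by
  have h0 : (extChartAt (𝓡 d) (1 : G)).symm (extChartAt (𝓡 d) (1 : G) 1) = 1 :=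
    extChartAt_to_inv (1 : G)
  have hs := chart_symm_smooth (d := d) (G := G)
  have h := mder_conj (hs.mdifferentiableAt (by simp)) h0 c
  rw [mder_chart_symm, ContinuousLinearMap.comp_id] at h
  rw [← h]
  exact mder_eq_chart (((contMDiffAt_const.mul hs).mul contMDiffAt_const).mdifferentiableAt
    (by simp)) (by simp)

theorem Ad_one : Ad d (1 : G) = ContinuousLinearMap.id ℝ (Eu d) := by
  rw [Ad_eq_chart, ← mder_chart_symm (G := G), mder_eq_chart
    (chart_symm_smooth.mdifferentiableAt (by simp)) (extChartAt_to_inv (1 : G))]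
  simp

theorem Ad_mul (a b : G) : Ad d (a * b) = (Ad d a).comp (Ad d b) := by
  have h0 : (extChartAt (𝓡 d) (1 : G)).symm (extChartAt (𝓡 d) (1 : G) 1) = 1 :=
    extChartAt_to_inv (1 : G)
  have hs := chart_symm_smooth (d := d) (G := G)
  have hsd := hs.mdifferentiableAt (show (∞ : WithTop ℕ∞) ≠ 0 by simp)
  have hsb := ((contMDiffAt_const.mul hs).mul contMDiffAt_const).mdifferentiableAt
    (show (∞ : WithTop ℕ∞) ≠ 0 by simp) (f := fun z =>
      b * (extChartAt (𝓡 d) (1 : G)).symm z * b⁻¹)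
  have h1 := mder_conj hsd h0 (a * b)
  have h2 := mder_conj hsb (by simp) a
  have h3 := mder_conj hsd h0 b
  rw [mder_chart_symm, ContinuousLinearMap.comp_id] at h1 h3
  rw [h3] at h2
  rw [← h1, ← h2]
  congr 1
  ext y; simp [mul_assoc]

theorem Ad_inv_comp (a : G) : (Ad d a⁻¹).comp (Ad d a) = ContinuousLinearMap.id ℝ _ := by
  rw [← Ad_mul]; simp [Ad_one]

/-- `Ad` is smooth along smooth maps. -/
theorem contDiffAt_Ad {g : W → G} {ξ : W → Eu d} {w : W}
    (hg : ContMDiffAt 𝓘(ℝ, W) (𝓡 d) ∞ g w) (hξ : ContDiffAt ℝ ∞ ξ w) :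
    ContDiffAt ℝ ∞ (fun y => Ad d (g y) (ξ y)) w := by
  simp only [Ad_eq_chart]
  have h0 : (extChartAt (𝓡 d) (1 : G)).symm (extChartAt (𝓡 d) (1 : G) 1) = 1 :=
    extChartAt_to_inv (1 : G)
  refine ContDiffAt.clm_apply ?_ hξ
  refine ContDiffAt.fderiv (n := ∞) (m := ∞) (f := fun y z => extChartAt (𝓡 d) (1 : G)
      (g y * (extChartAt (𝓡 d) (1 : G)).symm z * (g y)⁻¹)) ?_ contDiffAt_const (by simp)
  rw [← contMDiffAt_iff_contDiffAt]
  have hg' : ContMDiffAt 𝓘(ℝ, W × Eu d) (𝓡 d) ∞ (fun q : W × Eu d => g q.1)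
      (w, extChartAt (𝓡 d) (1 : G) 1) :=
    ContMDiffAt.comp (I' := 𝓘(ℝ, W)) (f := fun q : W × Eu d => q.1) (g := g) _ hg
      contDiffAt_fst.contMDiffAt
  have hs' : ContMDiffAt 𝓘(ℝ, W × Eu d) (𝓡 d) ∞
      (fun q : W × Eu d => (extChartAt (𝓡 d) (1 : G)).symm q.2) (w, extChartAt (𝓡 d) (1 : G) 1) :=
    ContMDiffAt.comp (I' := 𝓘(ℝ, Eu d)) (f := fun q : W × Eu d => q.2)
      (g := (extChartAt (𝓡 d) (1 : G)).symm) _ chart_symm_smooth contDiffAt_snd.contMDiffAt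
  have hm := (hg'.mul hs').mul hg'.inv
  refine ContMDiffAt.comp (I' := 𝓡 d) _ (g := extChartAt (𝓡 d) (1 : G)) ?_ hm
  simp only [h0, mul_one, mul_inv_cancel]
  exact contMDiffAt_chart_one

/-- Logarithmic derivatives depend smoothly on parameters. -/
theorem contDiffAt_logDer {V : Type*} [NormedAddCommGroup V] [NormedSpace ℝ V]
    {F : V × W → G} {a : V → W} {n : V}
    (hF : ContMDiff 𝓘(ℝ, V × W) (𝓡 d) ∞ F) (ha : ContDiffAt ℝ ∞ a n) (v : W) :
    ContDiffAt ℝ ∞ (fun y => logDer d (fun z => F (y, z)) (a y) v) n := by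
  have h1 : ∀ y, ContMDiff 𝓘(ℝ, W) (𝓡 d) ∞ (fun z => F (y, z)) := fun y =>
    hF.comp (contDiff_prodMk_right y).contMDiff
  have e : (fun y => logDer d (fun z => F (y, z)) (a y) v) = fun y =>
      fderiv ℝ (fun z => extChartAt (𝓡 d) (1 : G) ((F (y, a y))⁻¹ * F (y, z))) (a y) v := by
    ext1 y
    rw [logDer_eq_chart (h1 y _)]
  rw [e]
  refine ContDiffAt.clm_apply ?_ contDiffAt_const
  refine ContDiffAt.fderiv (n := ∞) (m := ∞) (f := fun y z => extChartAt (𝓡 d) (1 : G)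
      ((F (y, a y))⁻¹ * F (y, z))) ?_ ha (by simp)
  rw [← contMDiffAt_iff_contDiffAt]
  have ha' : ContMDiffAt 𝓘(ℝ, V × W) 𝓘(ℝ, V × W) ∞ (fun q : V × W => (q.1, a q.1)) (n, a n) :=
    (contDiffAt_fst.prodMk (ContDiffAt.comp (f := fun q : V × W => q.1) (g := a) _
      ha contDiffAt_fst)).contMDiffAt
  have hm := (ContMDiffAt.comp (I' := 𝓘(ℝ, V × W)) (g := F) _ (hF _) ha').inv.mul
    (hF (n, a n))
  refine ContMDiffAt.comp (I' := 𝓡 d) _ (g := extChartAt (𝓡 d) (1 : G)) ?_ hm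
  simp only [inv_mul_cancel]
  exact contMDiffAt_chart_one

/-- The chain rule for a smooth family of curves evaluated at a moving time. -/
theorem logDer_diag {F : W × ℝ → G} {τ : W → ℝ} {w : W}
    (hF : ContMDiff 𝓘(ℝ, W × ℝ) (𝓡 d) ∞ F) (hτ : ContDiffAt ℝ ∞ τ w) (v : W) :
    logDer d (fun y => F (y, τ y)) w v = logDer d (fun y => F (y, τ w)) w v
      + fderiv ℝ τ w v • logDer d (fun s => F (w, s)) (τ w) 1 := by
  have h1 : ContMDiff 𝓘(ℝ, W) (𝓡 d) ∞ (fun y => F (y, τ w)) :=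
    hF.comp (contDiff_prodMk_left (τ w)).contMDiff
  have h2 : ContMDiff 𝓘(ℝ, ℝ) (𝓡 d) ∞ (fun s => F (w, s)) :=
    hF.comp (contDiff_prodMk_right w).contMDiff
  set k : W × ℝ → Eu d := fun z => extChartAt (𝓡 d) (1 : G) ((F (w, τ w))⁻¹ * F z) with hk
  have hkd : DifferentiableAt ℝ k (w, τ w) := by
    have hm : ContMDiffAt 𝓘(ℝ, W × ℝ) (𝓡 d) ∞ (fun z => (F (w, τ w))⁻¹ * F z) (w, τ w) :=
      contMDiffAt_const.mul (hF _)
    have : ContMDiffAt 𝓘(ℝ, W × ℝ) 𝓘(ℝ, Eu d) ∞ k (w, τ w) := by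
      refine ContMDiffAt.comp (I' := 𝓡 d) _ (g := extChartAt (𝓡 d) (1 : G)) ?_ hm
      simp only [inv_mul_cancel]
      exact contMDiffAt_chart_one
    exact this.contDiffAt.differentiableAt (by simp)
  have hk' := hkd.hasFDerivAt
  have hc : HasFDerivAt (fun y => (y, τ y)) ((ContinuousLinearMap.id ℝ W).prod (fderiv ℝ τ w)) w :=
    (hasFDerivAt_id w).prodMk (hτ.differentiableAt (by simp)).hasFDerivAt
  have hd1 := (HasFDerivAt.comp (g := k) (f := fun y => (y, τ y)) w hk' hc).fderiv
  have hd2 := (HasFDerivAt.comp (g := k) (f := fun y => (y, τ w)) w hk'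
    ((hasFDerivAt_id w).prodMk (hasFDerivAt_const (τ w) w))).fderiv
  have hd3 := (HasFDerivAt.comp (g := k) (f := fun s => (w, s)) (τ w) hk'
    ((hasFDerivAt_const w (τ w)).prodMk (hasFDerivAt_id (τ w)))).fderiv
  have l1 : logDer d (fun y => F (y, τ y)) w v = fderiv ℝ k (w, τ w) (v, fderiv ℝ τ w v) := by
    have h0 : ContMDiffAt 𝓘(ℝ, W) (𝓡 d) ∞ (fun y => F (y, τ y)) w :=
      ContMDiffAt.comp (I' := 𝓘(ℝ, W × ℝ)) (g := F) (f := fun y => (y, τ y)) w (hF _)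
        (contDiffAt_id.prodMk hτ).contMDiffAt
    rw [logDer_eq_chart h0]
    exact congrArg (fun L => L v) hd1
  have l2 : logDer d (fun y => F (y, τ w)) w v = fderiv ℝ k (w, τ w) (v, 0) := by
    rw [logDer_eq_chart (h1 w)]
    exact congrArg (fun L => L v) hd2
  have l3 : logDer d (fun s => F (w, s)) (τ w) 1 = fderiv ℝ k (w, τ w) (0, 1) := by
    rw [logDer_eq_chart (h2 _)]
    exact congrArg (fun L => L 1) hd3
  rw [l1, l2, l3, ← map_smul, ← map_add]
  simp

end LieCalculus

/-! ### Diffeologies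

Manifolds, possibly modelled on Fréchet spaces, are regarded as diffeological spaces: the plots
of a manifold are the smooth maps from the spaces `ℝⁿ` to it. -/

section DiffeologyBasics

/-- Near each of its points, an open set of `ℝⁿ` is a smooth retract of `ℝⁿ`. -/
theorem exists_retract {n : ℕ} {u : Set (Eu n)} (hu : IsOpen u) {x : Eu n} (hx : x ∈ u) :
    ∃ f : Eu n → Eu n, ContDiff ℝ ∞ f ∧ (∀ y, f y ∈ u) ∧ ∀ᶠ y in 𝓝 x, f y = y := by
  obtain ⟨r, hr, hru⟩ := Metric.isOpen_iff.1 hu x hx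
  let b : ContDiffBump x := ⟨r / 4, r / 2, by positivity, by linarith⟩
  refine ⟨fun y => x + b y • (y - x), ?_, fun y => hru ?_, ?_⟩
  · exact contDiff_const.add (b.contDiff.smul (contDiff_id.sub contDiff_const))
  · rw [Metric.mem_ball, dist_eq_norm, add_sub_cancel_left, norm_smul, Real.norm_eq_abs,
      abs_of_nonneg b.nonneg]
    by_cases hy : y ∈ Metric.ball x (r / 2)
    · rw [Metric.mem_ball, dist_eq_norm] at hy
      have h1 : b y ≤ 1 := b.le_one
      have h0 : 0 ≤ b y := b.nonneg
      nlinarith [norm_nonneg (y - x)]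
    · have : b y = 0 := b.zero_of_le_dist (by simpa [b] using hy)
      rw [this, zero_mul]; exact hr
  · filter_upwards [b.eventuallyEq_one] with y hy
    rw [hy]; simp

/-- The diffeology whose plots are the maps that satisfy a local condition at every point. -/
abbrev localDiffeology {X : Type*} (L : ∀ n, (Eu n → X) → Eu n → Prop)
    (hconst : ∀ n (a : X) (x : Eu n), L n (fun _ => a) x)
    (hcongr : ∀ n (p q : Eu n → X) (x : Eu n), p =ᶠ[𝓝 x] q → L n p x → L n q x)
    (hcomp : ∀ m n (p : Eu m → X) (f : Eu n → Eu m) (x : Eu n), ContDiff ℝ ∞ f → L m p (f x) →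
      L n (p ∘ f) x) : DiffeologicalSpace X where
  plots n := {p | ∀ x, L n p x}
  constant_plots a x := hconst _ a x
  plot_reparam hp hf x := hcomp _ _ _ _ x hf (hp _)
  locality {n p} hp x := by
    obtain ⟨u, hu, hxu, h⟩ := hp x
    obtain ⟨f, hf, hfu, hfx⟩ := exists_retract hu hxu
    refine hcongr n (p ∘ f) p x ?_ (h hfu hf x)
    filter_upwards [hfx] with y hy
    simp [hy]

theorem isPlot_of_locally {X : Type*} [DiffeologicalSpace X] {n : ℕ} {p : Eu n → X}
    (h : ∀ x, ∃ q : Eu n → X, IsPlot q ∧ p =ᶠ[𝓝 x] q) : IsPlot p := by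
  refine DiffeologicalSpace.locality fun x => ?_
  obtain ⟨q, hq, e⟩ := h x
  obtain ⟨u, hu, huo, hxu⟩ := eventually_nhds_iff.1 e
  refine ⟨u, huo, hxu, fun {m f} hf hfs => ?_⟩
  have : p ∘ f = q ∘ f := by ext y; exact hu _ (hf y)
  rw [this]
  exact isPlot_reparam hq hfs

/-- The product diffeology. -/
instance prodDiffeology {X Y : Type*} [DiffeologicalSpace X] [DiffeologicalSpace Y] :
    DiffeologicalSpace (X × Y) where
  plots n := {p | IsPlot (fun x => (p x).1) ∧ IsPlot (fun x => (p x).2)}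
  constant_plots a := ⟨isPlot_const, isPlot_const⟩
  plot_reparam hp hf := ⟨isPlot_reparam hp.1 hf, isPlot_reparam hp.2 hf⟩
  locality {n p} hp := by
    constructor
    · refine DiffeologicalSpace.locality fun x => ?_
      obtain ⟨u, hu, hxu, h⟩ := hp x
      exact ⟨u, hu, hxu, fun hf hfs => (h hf hfs).1⟩
    · refine DiffeologicalSpace.locality fun x => ?_
      obtain ⟨u, hu, hxu, h⟩ := hp x
      exact ⟨u, hu, hxu, fun hf hfs => (h hf hfs).2⟩

/-- The quotient diffeology along a surjection `π : X → Y`: plots lift locally to `X`. -/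
abbrev quotientDiffeology {X Y : Type*} [DiffeologicalSpace X] (π : X → Y)
    (hπ : Function.Surjective π) : DiffeologicalSpace Y :=
  localDiffeology (fun n q x => ∃ r : Eu n → X, IsPlot r ∧ q =ᶠ[𝓝 x] fun y => π (r y))
    (fun n a x => by
      obtain ⟨b, rfl⟩ := hπ a
      exact ⟨fun _ => b, isPlot_const, Filter.EventuallyEq.rfl⟩)
    (fun n p q x e h => by
      obtain ⟨r, hr, h⟩ := h
      exact ⟨r, hr, e.symm.trans h⟩)
    (fun m n p f x hf h => by
      obtain ⟨r, hr, h⟩ := h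
      exact ⟨r ∘ f, isPlot_reparam hr hf, hf.continuous.continuousAt.eventually h⟩)

/-- The circle `S¹ = ℝ / 2πℤ`, as a quotient of `ℝ`. -/
instance angleDiffeology : DiffeologicalSpace Real.Angle :=
  quotientDiffeology (fun t : ℝ => (t : Real.Angle)) QuotientAddGroup.mk_surjective

set_option synthInstance.checkSynthOrder false in
/-- The diffeology of a finite-dimensional manifold. -/
instance (priority := 10) manifoldDiffeology {d : ℕ} {G : Type*} [TopologicalSpace G]
    [ChartedSpace (Eu d) G] : DiffeologicalSpace G :=
  localDiffeology (fun n g x => ContMDiffAt 𝓘(ℝ, Eu n) (𝓡 d) ∞ g x)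
    (fun _ _ _ => contMDiffAt_const)
    (fun _ _ _ _ e h => h.congr_of_eventuallyEq e.symm)
    (fun _ _ _ _ _ hf h => h.comp _ hf.contMDiff.contMDiffAt)

end DiffeologyBasics

/-! ### The loop group and its Lie algebra -/

section Loops

/-- The based loop group `ΩG`: smooth maps `S¹ → G` whose value at `0` is `1`. -/
@[ext]
structure LoopGroup (d : ℕ) (G : Type*) [TopologicalSpace G] [ChartedSpace (Eu d) G]
    [Group G] where
  toFun : Real.Angle → G
  smooth : ContMDiff 𝓘(ℝ, ℝ) (𝓡 d) ∞ (fun t : ℝ => toFun t)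
  map_zero : toFun 0 = 1

variable {d : ℕ} {G : Type*} [TopologicalSpace G] [ChartedSpace (Eu d) G] [Group G]

instance : CoeFun (LoopGroup d G) (fun _ => Real.Angle → G) := ⟨LoopGroup.toFun⟩

/-- The diffeology of `ΩG`: a family of loops is smooth if it is jointly smooth. -/
instance : DiffeologicalSpace (LoopGroup d G) :=
  localDiffeology (fun n γ x => ∀ t : ℝ,
      ContMDiffAt 𝓘(ℝ, Eu n × ℝ) (𝓡 d) ∞ (fun z : Eu n × ℝ => γ z.1 z.2) (x, t))
    (fun n γ x t => ContMDiffAt.comp (I' := 𝓘(ℝ, ℝ)) (f := fun z : Eu n × ℝ => z.2)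
      (g := fun t : ℝ => γ t) _ (γ.smooth t) contDiffAt_snd.contMDiffAt)
    (fun n p q x e h t => (h t).congr_of_eventuallyEq (by
      have : ∀ᶠ z in 𝓝 (x, t), p z.1 = q z.1 := (continuousAt_fst (p := (x, t))).eventually e
      filter_upwards [this] with z hz
      rw [hz]))
    (fun m n p f x hf h t => ContMDiffAt.comp (I' := 𝓘(ℝ, Eu m × ℝ))
      (g := fun z : Eu m × ℝ => p z.1 z.2) (f := fun z : Eu n × ℝ => (f z.1, z.2)) (x, t) (h t)
      ((hf.comp contDiff_fst).prodMk contDiff_snd).contMDiff.contMDiffAt)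

theorem LoopGroup.isPlot_iff {n : ℕ} {γ : Eu n → LoopGroup d G} :
    IsPlot γ ↔ ContMDiff 𝓘(ℝ, Eu n × ℝ) (𝓡 d) ∞ (fun z : Eu n × ℝ => γ z.1 z.2) :=
  ⟨fun h z => h z.1 z.2, fun h x t => h (x, t)⟩

/-- Pointwise multiplication of loops. -/
instance [LieGroup (𝓡 d) ∞ G] : Group (LoopGroup d G) where
  mul a b := ⟨fun θ => a θ * b θ, a.smooth.mul b.smooth, by rw [a.map_zero, b.map_zero, mul_one]⟩
  one := ⟨fun _ => 1, contMDiff_const, rfl⟩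
  inv a := ⟨fun θ => (a θ)⁻¹, a.smooth.inv, by rw [a.map_zero, inv_one]⟩
  mul_assoc a b c := LoopGroup.ext (funext fun θ => mul_assoc (a θ) (b θ) (c θ))
  one_mul a := LoopGroup.ext (funext fun θ => one_mul (a θ))
  mul_one a := LoopGroup.ext (funext fun θ => mul_one (a θ))
  inv_mul_cancel a := LoopGroup.ext (funext fun θ => inv_mul_cancel (a θ))

section
variable [LieGroup (𝓡 d) ∞ G]

@[simp] theorem LoopGroup.mul_apply (a b : LoopGroup d G) (θ : Real.Angle) :
    (a * b) θ = a θ * b θ := rfl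

@[simp] theorem LoopGroup.inv_apply (a : LoopGroup d G) (θ : Real.Angle) :
    (a⁻¹) θ = (a θ)⁻¹ := rfl

@[simp] theorem LoopGroup.one_apply (θ : Real.Angle) : (1 : LoopGroup d G) θ = 1 := rfl

theorem LoopGroup.isPlot_mul {n : ℕ} {a b : Eu n → LoopGroup d G} (ha : IsPlot a)
    (hb : IsPlot b) : IsPlot (fun x => a x * b x) :=
  LoopGroup.isPlot_iff.2 ((LoopGroup.isPlot_iff.1 ha).mul (LoopGroup.isPlot_iff.1 hb))

theorem LoopGroup.isPlot_inv {n : ℕ} {a : Eu n → LoopGroup d G} (ha : IsPlot a) :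
    IsPlot (fun x => (a x)⁻¹) :=
  LoopGroup.isPlot_iff.2 (LoopGroup.isPlot_iff.1 ha).inv
end

/-- The smooth maps `S¹ → 𝔤`. -/
def LAlg (d : ℕ) : Submodule ℝ (Real.Angle → Eu d) where
  carrier := {f | ContDiff ℝ ∞ (fun t : ℝ => f t)}
  add_mem' {f g} hf hg := by
    change ContDiff ℝ ∞ (fun t : ℝ => f t + g t)
    exact ContDiff.add hf hg
  zero_mem' := by
    change ContDiff ℝ ∞ (fun _ : ℝ => (0 : Eu d))
    exact contDiff_const
  smul_mem' c f hf := by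
    change ContDiff ℝ ∞ (fun t : ℝ => c • f t)
    change ContDiff ℝ ∞ (fun t : ℝ => f t) at hf
    exact hf.const_smul c

/-- The Lie algebra `Ω𝔤` of `ΩG`: the smooth maps `S¹ → 𝔤` whose value at `0` is `0`. -/
def OmegaAlg (d : ℕ) : Submodule ℝ (Real.Angle → Eu d) where
  carrier := {f | ContDiff ℝ ∞ (fun t : ℝ => f t) ∧ f 0 = 0}
  add_mem' hf hg := ⟨ContDiff.add hf.1 hg.1, by simp [hf.2, hg.2]⟩
  zero_mem' := ⟨contDiff_const (c := (0 : Eu d)), rfl⟩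
  smul_mem' c _ hf := ⟨contDiff_const.smul hf.1, by simp [hf.2]⟩

/-- The diffeology of a space of smooth maps `S¹ → 𝔤`: smoothness is joint smoothness. -/
abbrev loopAlgDiffeology (V : Submodule ℝ (Real.Angle → Eu d))
    (hV : ∀ f ∈ V, ContDiff ℝ ∞ (fun t : ℝ => f t)) : DiffeologicalSpace V :=
  localDiffeology (fun n ξ x => ∀ t : ℝ,
      ContDiffAt ℝ ∞ (fun z : Eu n × ℝ => (ξ z.1 : Real.Angle → Eu d) z.2) (x, t))
    (fun n ξ x t => ContDiffAt.comp (f := fun z : Eu n × ℝ => z.2)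
      (g := fun t : ℝ => (ξ : Real.Angle → Eu d) t) (x, t)
      (hV _ ξ.2).contDiffAt contDiffAt_snd)
    (fun n p q x e h t => (h t).congr_of_eventuallyEq (by
      have : ∀ᶠ z in 𝓝 (x, t), p z.1 = q z.1 := (continuousAt_fst (p := (x, t))).eventually e
      filter_upwards [this] with z hz
      rw [hz]))
    (fun m n p f x hf h t => ContDiffAt.comp
      (g := fun z : Eu m × ℝ => (p z.1 : Real.Angle → Eu d) z.2)
      (f := fun z : Eu n × ℝ => (f z.1, z.2)) (x, t) (h t)
      ((hf.comp contDiff_fst).prodMk contDiff_snd).contDiffAt)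

instance : DiffeologicalSpace (LAlg d) := loopAlgDiffeology _ fun _ hf => hf

instance : DiffeologicalSpace (OmegaAlg d) := loopAlgDiffeology _ fun _ hf => hf.1

variable [LieGroup (𝓡 d) ∞ G]

/-- The pointwise adjoint action of `ΩG` on `Ω𝔤`. -/
def loopAd (γ : LoopGroup d G) (ξ : OmegaAlg d) : OmegaAlg d :=
  ⟨fun θ => Ad d (γ θ) ((ξ : Real.Angle → Eu d) θ),
    contDiff_iff_contDiffAt.2 fun t => contDiffAt_Ad (γ.smooth t) ξ.2.1.contDiffAt, by
      simp only [ξ.2.2, map_zero]⟩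

end Loops

/-! ### Differential forms on diffeological spaces -/

section Forms

/-- A differential 1-form on `X` with values in `V`: a 1-form on the domain of every plot,
compatible with smooth changes of plots. For a manifold `X`, possibly modelled on a Fréchet
space, `α.toFun p _ x` is `α ∘ d p (x)`. -/
@[ext]
structure OneForm (X V : Type*) [DiffeologicalSpace X] [AddCommGroup V] [Module ℝ V]
    [DiffeologicalSpace V] where
  toFun : ∀ {n : ℕ} (p : Eu n → X), IsPlot p → Eu n → (Eu n →ₗ[ℝ] V)
  smooth : ∀ {n : ℕ} (p : Eu n → X) (hp : IsPlot p) (v : Eu n), IsPlot (fun x => toFun p hp x v)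
  reparam : ∀ {m n : ℕ} (p : Eu m → X) (hp : IsPlot p) (f : Eu n → Eu m) (hf : ContDiff ℝ ∞ f)
    (x v : Eu n), toFun (p ∘ f) (isPlot_reparam hp hf) x v = toFun p hp (f x) (fderiv ℝ f x v)

namespace OneForm

variable {X V : Type*} [DiffeologicalSpace X] [AddCommGroup V] [Module ℝ V]
  [DiffeologicalSpace V] (α : OneForm X V)

theorem toFun_congr {n : ℕ} {p q : Eu n → X} (hp : IsPlot p) (hq : IsPlot q) {x : Eu n}
    (e : p =ᶠ[𝓝 x] q) : α.toFun p hp x = α.toFun q hq x := by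
  obtain ⟨u, hu, huo, hxu⟩ := eventually_nhds_iff.1 e
  obtain ⟨f, hf, hfu, hfx⟩ := exists_retract huo hxu
  have hpq : p ∘ f = q ∘ f := by ext y; exact hu _ (hfu y)
  have hfd : fderiv ℝ f x = ContinuousLinearMap.id ℝ _ := by
    have : f =ᶠ[𝓝 x] id := hfx
    rw [this.fderiv_eq, fderiv_id]
  ext v
  have h1 := α.reparam p hp f hf x v
  have h2 := α.reparam q hq f hf x v
  simp only [hpq] at h1
  rw [hfd, hfx.self_of_nhds] at h1 h2
  exact h1.symm.trans h2

theorem toFun_const {n : ℕ} (a : X) (x : Eu n) : α.toFun (fun _ => a) isPlot_const x = 0 := by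
  ext v
  have h := α.reparam (fun _ : Eu n => a) isPlot_const (fun _ => x) contDiff_const x v
  rw [(hasFDerivAt_const x x).fderiv, zero_apply, map_zero] at h
  exact h

/-- The value `α(∂c)` of a 1-form on the velocity of a smooth curve at time `t`. -/
def onCurve (c : ℝ → X) (hc : DSmooth c) (t : ℝ) : V :=
  α.toFun (fun x : Eu 1 => c (x 0))
    (hc 1 (fun x => x 0) (ContDiff.isPlot (by fun_prop)))
    (EuclideanSpace.single 0 t) (EuclideanSpace.single 0 1)

open Classical in
/-- A 1-form whose values only depend on the projected plots descends along a map
`π : X → Y` to whose source all plots of `Y` lift locally. -/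
def descend {Y : Type*} [DiffeologicalSpace Y] (π : X → Y)
    (hπ : ∀ {n : ℕ} (q : Eu n → Y), IsPlot q → ∀ x, ∃ r : Eu n → X, IsPlot r ∧
      q =ᶠ[𝓝 x] fun y => π (r y))
    (h : ∀ {n : ℕ} (r s : Eu n → X) (hr : IsPlot r) (hs : IsPlot s) (x : Eu n),
      (∀ y, π (r y) = π (s y)) → α.toFun r hr x = α.toFun s hs x) :
    OneForm Y V :=
  have h' : ∀ {n : ℕ} (r s : Eu n → X) (hr : IsPlot r) (hs : IsPlot s) (x : Eu n),
      (∀ᶠ y in 𝓝 x, π (r y) = π (s y)) → α.toFun r hr x = α.toFun s hs x := by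
    intro n r s hr hs x e
    obtain ⟨u, hu, huo, hxu⟩ := eventually_nhds_iff.1 e
    obtain ⟨f, hf, hfu, hfx⟩ := exists_retract huo hxu
    have e1 : r =ᶠ[𝓝 x] r ∘ f := by filter_upwards [hfx] with y hy using by simp [hy]
    have e2 : s =ᶠ[𝓝 x] s ∘ f := by filter_upwards [hfx] with y hy using by simp [hy]
    rw [α.toFun_congr hr (isPlot_reparam hr hf) e1, α.toFun_congr hs (isPlot_reparam hs hf) e2]
    exact h _ _ _ _ x fun y => hu _ (hfu y)
  { toFun := fun q hq x => α.toFun (hπ q hq x).choose (hπ q hq x).choose_spec.1 x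
    smooth := fun q hq v => isPlot_of_locally fun x₀ => by
      obtain ⟨hr, e⟩ := (hπ q hq x₀).choose_spec
      refine ⟨_, α.smooth _ hr v, ?_⟩
      filter_upwards [e.eventually_nhds] with y hy
      have e' := (hπ q hq y).choose_spec.2
      refine congrArg (fun L => L v) (h' _ _ _ _ y ?_)
      filter_upwards [hy, e'] with z h1 h2 using h2.symm.trans h1
    reparam := fun q hq f hf x v => by
      have e1 := (hπ (q ∘ f) (isPlot_reparam hq hf) x).choose_spec.2
      obtain ⟨hr, e⟩ := (hπ q hq (f x)).choose_spec
      rw [← α.reparam _ hr f hf x v]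
      refine congrArg (fun L => L v) (h' _ _ _ _ x ?_)
      filter_upwards [e1, hf.continuous.continuousAt.eventually e] with z h1 h2
      exact h1.symm.trans h2 }

theorem descend_toFun {Y : Type*} [DiffeologicalSpace Y] (π : X → Y)
    (hπ : ∀ {n : ℕ} (q : Eu n → Y), IsPlot q → ∀ x, ∃ r : Eu n → X, IsPlot r ∧
      q =ᶠ[𝓝 x] fun y => π (r y))
    (h : ∀ {n : ℕ} (r s : Eu n → X) (hr : IsPlot r) (hs : IsPlot s) (x : Eu n),
      (∀ y, π (r y) = π (s y)) → α.toFun r hr x = α.toFun s hs x)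
    {n : ℕ} (q : Eu n → Y) (hq : IsPlot q) (s : Eu n → X) (hs : IsPlot s) (x : Eu n)
    (e : q =ᶠ[𝓝 x] fun y => π (s y)) :
    (α.descend π hπ h).toFun q hq x = α.toFun s hs x := by
  obtain ⟨hr, e1⟩ := (hπ q hq x).choose_spec
  obtain ⟨u, hu, huo, hxu⟩ := eventually_nhds_iff.1 (e1.symm.trans e)
  obtain ⟨f, hf, hfu, hfx⟩ := exists_retract huo hxu
  have e3 : (hπ q hq x).choose =ᶠ[𝓝 x] (hπ q hq x).choose ∘ f := by
    filter_upwards [hfx] with y hy using by simp [hy]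
  have e2 : s =ᶠ[𝓝 x] s ∘ f := by filter_upwards [hfx] with y hy using by simp [hy]
  change α.toFun (hπ q hq x).choose hr x = _
  rw [α.toFun_congr hr (isPlot_reparam hr hf) e3, α.toFun_congr hs (isPlot_reparam hs hf) e2]
  exact h _ _ _ _ x fun y => hu _ (hfu y)

end OneForm

/-- The Maurer-Cartan form `Θ = g⁻¹ dg` of a Lie group. -/
def maurerCartan (d : ℕ) (G : Type*) [TopologicalSpace G] [ChartedSpace (Eu d) G] [Group G]
    [LieGroup (𝓡 d) ∞ G] : OneForm G (Eu d) where
  toFun g _ x := (logDer d g x).toLinearMap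
  smooth {n} g hg v := by
    have hF : ContMDiff 𝓘(ℝ, Eu n × Eu n) (𝓡 d) ∞ (fun z : Eu n × Eu n => g z.2) :=
      ContMDiff.comp (I' := 𝓘(ℝ, Eu n)) (g := g) (fun x => hg x) contDiff_snd.contMDiff
    exact ContDiff.isPlot (contDiff_iff_contDiffAt.2 fun x =>
      contDiffAt_logDer (F := fun z : Eu n × Eu n => g z.2) (a := id) hF contDiffAt_id v)
  reparam g hg f hf x v := logDer_comp (hg (f x)) (hf.contDiffAt.differentiableAt (by simp)) v

theorem contDiff_loopLogDer {d : ℕ} {G : Type*} [TopologicalSpace G] [ChartedSpace (Eu d) G]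
    [Group G] [LieGroup (𝓡 d) ∞ G] {n : ℕ} {γ : Eu n → LoopGroup d G} (hγ : IsPlot γ) (v : Eu n) :
    ContDiff ℝ ∞ (fun q : Eu n × ℝ => logDer d (fun z => γ z q.2) q.1 v) := by
  have hF : ContMDiff 𝓘(ℝ, (Eu n × ℝ) × Eu n) (𝓡 d) ∞
      (fun w : (Eu n × ℝ) × Eu n => γ w.2 w.1.2) :=
    ContMDiff.comp (I' := 𝓘(ℝ, Eu n × ℝ)) (g := fun z : Eu n × ℝ => γ z.1 z.2)
      (f := fun w : (Eu n × ℝ) × Eu n => (w.2, w.1.2)) (LoopGroup.isPlot_iff.1 hγ)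
      (contDiff_snd.prodMk (contDiff_snd.comp contDiff_fst)).contMDiff
  exact contDiff_iff_contDiffAt.2 fun q =>
    contDiffAt_logDer (F := fun w : (Eu n × ℝ) × Eu n => γ w.2 w.1.2)
      (a := fun q : Eu n × ℝ => q.1) hF contDiffAt_fst v

theorem LoopGroup.contMDiff_eval {d : ℕ} {G : Type*} [TopologicalSpace G] [ChartedSpace (Eu d) G]
    [Group G] {n : ℕ} {γ : Eu n → LoopGroup d G} (hγ : IsPlot γ)
    (θ : Real.Angle) : ContMDiff 𝓘(ℝ, Eu n) (𝓡 d) ∞ (fun y => γ y θ) := by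
  obtain ⟨t, rfl⟩ := QuotientAddGroup.mk_surjective θ
  exact ContMDiff.comp (I' := 𝓘(ℝ, Eu n × ℝ)) (g := fun z : Eu n × ℝ => γ z.1 z.2)
      (f := fun y : Eu n => (y, t)) (LoopGroup.isPlot_iff.1 hγ)
      (contDiff_prodMk_left t).contMDiff

/-- The Maurer-Cartan form of the loop group `ΩG`: the one of `G`, pointwise. -/
def loopMaurerCartan (d : ℕ) (G : Type*) [TopologicalSpace G] [ChartedSpace (Eu d) G] [Group G]
    [LieGroup (𝓡 d) ∞ G] : OneForm (LoopGroup d G) (OmegaAlg d) where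
  toFun {n} γ hγ x :=
    { toFun := fun v => ⟨fun θ => logDer d (fun y => γ y θ) x v,
        (contDiff_loopLogDer hγ v).comp (contDiff_prodMk_right x), by
          simp only [LoopGroup.map_zero, logDer_const, zero_apply]⟩
      map_add' := fun v w => by ext1; funext θ; exact map_add (logDer d (fun y => γ y θ) x) v w
      map_smul' := fun c v => by ext1; funext θ; exact map_smul (logDer d (fun y => γ y θ) x) c v }
  smooth {n} γ hγ v := fun x t => (contDiff_loopLogDer hγ v).contDiffAt
  reparam γ hγ f hf x v := by
    ext1; funext θ
    exact logDer_comp (g := fun y => γ y θ) (LoopGroup.contMDiff_eval hγ θ (f x))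
      (hf.contDiffAt.differentiableAt (by simp)) v

end Forms

/-! ### Principal bundles, connections and Higgs fields -/

section Bundles

/-- A smooth, locally trivial principal bundle `P → X` with structure group `𝒢` acting on the
right. Over an open set `U`, the map `(y, g) ↦ s(y) g` is a diffeomorphism `U × 𝒢 ≃ P|U` with
inverse `p ↦ (proj p, φ p)`. -/
structure PrincipalBundle (𝒢 P X : Type*) [Group 𝒢] [DiffeologicalSpace 𝒢]
    [DiffeologicalSpace P] [DiffeologicalSpace X] where
  proj : P → X
  act : P → 𝒢 → P
  act_one : ∀ p, act p 1 = p
  act_mul : ∀ p a b, act p (a * b) = act (act p a) b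
  proj_act : ∀ p g, proj (act p g) = proj p
  smooth_proj : DSmooth proj
  smooth_act : DSmooth (fun z : P × 𝒢 => act z.1 z.2)
  locally_trivial : ∀ x : X, ∃ (U : Set X) (s : X → P) (φ : P → 𝒢),
    IsOpen[dTopology] U ∧ x ∈ U ∧
    (∀ y ∈ U, proj (s y) = y) ∧
    (∀ p, proj p ∈ U → act (s (proj p)) (φ p) = p) ∧
    (∀ y ∈ U, ∀ g, φ (act (s y) g) = g) ∧
    (∀ {n : ℕ} (q : Eu n → X), IsPlot q → (∀ z, q z ∈ U) → IsPlot (fun z => s (q z))) ∧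
    (∀ {n : ℕ} (r : Eu n → P), IsPlot r → (∀ z, proj (r z) ∈ U) → IsPlot (fun z => φ (r z)))

namespace PrincipalBundle

variable {𝒢 P X : Type*} [Group 𝒢] [DiffeologicalSpace 𝒢] [DiffeologicalSpace P]
  [DiffeologicalSpace X] (B : PrincipalBundle 𝒢 P X)

theorem isPlot_act {n : ℕ} {p : Eu n → P} {g : Eu n → 𝒢} (hp : IsPlot p) (hg : IsPlot g) :
    IsPlot (fun x => B.act (p x) (g x)) :=
  B.smooth_act n (fun x => (p x, g x)) ⟨hp, hg⟩

theorem proj_surjective : Function.Surjective B.proj := fun x => by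
  obtain ⟨U, s, φ, -, hx, h, -⟩ := B.locally_trivial x
  exact ⟨s x, h x hx⟩

theorem act_injective {p : P} {a b : 𝒢} (h : B.act p a = B.act p b) : a = b := by
  obtain ⟨U, s, φ, -, hx, h1, h2, h3, -⟩ := B.locally_trivial (B.proj p)
  have h4 := h2 p hx
  rw [← h4, ← B.act_mul, ← B.act_mul] at h
  have := congrArg φ h
  rw [h3 _ hx, h3 _ hx] at this
  exact mul_left_cancel this

theorem exists_act_eq {p q : P} (h : B.proj p = B.proj q) : ∃ g, q = B.act p g := by
  obtain ⟨U, s, φ, -, hx, h1, h2, h3, -⟩ := B.locally_trivial (B.proj p)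
  refine ⟨(φ p)⁻¹ * φ q, ?_⟩
  have h4 := h2 p hx
  have h5 := h2 q (h ▸ hx)
  rw [← h] at h5
  calc q = B.act (B.act (s (B.proj p)) (φ p)) ((φ p)⁻¹ * φ q) := by
        rw [← B.act_mul, mul_inv_cancel_left, h5]
    _ = B.act p ((φ p)⁻¹ * φ q) := by rw [h4]

open Classical in
/-- The element `g` with `q = p g`, for `p` and `q` in the same fibre. -/
def div (p q : P) : 𝒢 := if h : ∃ g, q = B.act p g then h.choose else 1

/-- A connection form on a principal bundle: `ι_p^* A = Θ` for the orbit maps `ι_p : g ↦ p g`,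
and `R_g^* A = ad(g⁻¹) A` for the right translations `R_g : p ↦ p g`. -/
structure Connection {𝔥 : Type*} [AddCommGroup 𝔥] [Module ℝ 𝔥] [DiffeologicalSpace 𝔥]
    (ad : 𝒢 → 𝔥 → 𝔥) (Θ : OneForm 𝒢 𝔥) where
  form : OneForm P 𝔥
  vertical : ∀ (p : P) {n : ℕ} (g : Eu n → 𝒢) (hg : IsPlot g) (x v : Eu n),
    form.toFun (fun y => B.act p (g y)) (B.isPlot_act isPlot_const hg) x v = Θ.toFun g hg x v
  equivariant : ∀ {n : ℕ} (p : Eu n → P) (hp : IsPlot p) (g : 𝒢) (x v : Eu n),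
    form.toFun (fun y => B.act (p y) g) (B.isPlot_act hp isPlot_const) x v
      = ad g⁻¹ (form.toFun p hp x v)

theorem Connection.toFun_act {𝔥 : Type*} [AddCommGroup 𝔥] [Module ℝ 𝔥] [DiffeologicalSpace 𝔥]
    {ad : 𝒢 → 𝔥 → 𝔥} {Θ : OneForm 𝒢 𝔥} {B : PrincipalBundle 𝒢 P X} (A : B.Connection ad Θ)
    {n : ℕ} (p : Eu n → P) (hp : IsPlot p)
    (g : Eu n → 𝒢) (hg : IsPlot g) (x v : Eu n) :
    A.form.toFun (fun y => B.act (p y) (g y)) (B.isPlot_act hp hg) x v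
      = ad (g x)⁻¹ (A.form.toFun p hp x v) + Θ.toFun g hg x v := by
  let e : Eu (n + n) ≃L[ℝ] Eu n × Eu n := EuclideanSpace.finAddEquivProd
  let p2 : Eu (n + n) → P := fun z => p (e z).1
  let g2 : Eu (n + n) → 𝒢 := fun z => g (e z).2
  have hp2 : IsPlot p2 := isPlot_reparam hp (f := fun z => (e z).1) (by fun_prop)
  have hg2 : IsPlot g2 := isPlot_reparam hg (f := fun z => (e z).2) (by fun_prop)
  have h2 := B.isPlot_act hp2 hg2
  have key : ∀ L : Eu n →L[ℝ] Eu n × Eu n, ∀ c : Eu n × Eu n,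
      ∀ hq : IsPlot (fun y => B.act (p (L y + c).1) (g (L y + c).2)),
      A.form.toFun (fun y => B.act (p (L y + c).1) (g (L y + c).2)) hq x v
        = A.form.toFun (fun z => B.act (p2 z) (g2 z)) h2 (e.symm (L x + c)) (e.symm (L v)) := by
    intro L c hq
    have hf : ContDiff ℝ ∞ (fun y => e.symm (L y + c)) := by fun_prop
    have hd : HasFDerivAt (fun y => e.symm (L y + c))
        ((e.symm : Eu n × Eu n →L[ℝ] Eu (n + n)).comp L) x :=
      (e.symm : Eu n × Eu n →L[ℝ] Eu (n + n)).hasFDerivAt.comp x (L.hasFDerivAt.add_const c)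
    have := A.form.reparam _ h2 _ hf x v
    rw [hd.fderiv] at this
    refine Eq.trans ?_ this
    have e0 : (fun y => B.act (p (L y + c).1) (g (L y + c).2))
      = (fun z => B.act (p2 z) (g2 z)) ∘ fun y => e.symm (L y + c) := by
      funext y
      simp [p2, g2]
    simp only [e0]
  have k1 := key ((ContinuousLinearMap.id ℝ _).prod (ContinuousLinearMap.id ℝ _)) 0
    (by simpa using B.isPlot_act hp hg)
  have k2 := key ((ContinuousLinearMap.id ℝ _).prod 0) (0, x)
    (by simpa using B.isPlot_act hp (isPlot_const (x := g x)))
  have k3 := key (ContinuousLinearMap.prod 0 (ContinuousLinearMap.id ℝ _)) (x, 0)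
    (by simpa using B.isPlot_act (isPlot_const (x := p x)) hg)
  simp at k1 k2 k3
  rw [k1]
  have : ((v, v) : Eu n × Eu n) = (v, 0) + (0, v) := by simp
  rw [this, map_add, map_add, ← k2, ← k3, A.vertical, A.equivariant]

end PrincipalBundle

end Bundles

/-! ### The caloron transform -/

section Caloron

theorem exists_angle_lift {n : ℕ} {θ : Eu n → Real.Angle} (hθ : IsPlot θ) (x : Eu n) :
    ∃ τ : Eu n → ℝ, ContDiff ℝ ∞ τ ∧ θ =ᶠ[𝓝 x] fun y => (τ y : Real.Angle) := by
  obtain ⟨τ, h, e⟩ := hθ x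
  exact ⟨τ, h, e⟩

theorem LoopGroup.contMDiffAt_eval {d : ℕ} {G : Type*} [TopologicalSpace G]
    [ChartedSpace (Eu d) G] [Group G] {n : ℕ} {γ : Eu n → LoopGroup d G} (hγ : IsPlot γ)
    {θ : Eu n → Real.Angle} (hθ : IsPlot θ) (x : Eu n) :
    ContMDiffAt 𝓘(ℝ, Eu n) (𝓡 d) ∞ (fun y => γ y (θ y)) x := by
  obtain ⟨τ, hτ, e⟩ := exists_angle_lift hθ x
  have h : ContMDiffAt 𝓘(ℝ, Eu n) (𝓡 d) ∞ (fun y => γ y (τ y)) x :=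
    ContMDiffAt.comp (I' := 𝓘(ℝ, Eu n × ℝ)) (g := fun z : Eu n × ℝ => γ z.1 z.2)
      (f := fun y => (y, τ y)) x (LoopGroup.isPlot_iff.1 hγ _)
      (contDiff_id.prodMk hτ).contMDiff.contMDiffAt
  refine h.congr_of_eventuallyEq ?_
  filter_upwards [e] with y hy using by rw [hy]

/-- A connection on a `G`-bundle: a `𝔤`-valued 1-form on the total space. -/
abbrev GConnection (d : ℕ) {G : Type*} [TopologicalSpace G] [ChartedSpace (Eu d) G] [Group G]
    [LieGroup (𝓡 d) ∞ G] {Q X : Type*} [DiffeologicalSpace Q] [DiffeologicalSpace X]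
    (B : PrincipalBundle G Q X) :=
  B.Connection (fun g ξ => Ad d g ξ) (maurerCartan d G)

variable {d : ℕ} {G : Type*} [TopologicalSpace G] [ChartedSpace (Eu d) G] [Group G]
  [LieGroup (𝓡 d) ∞ G] {P M : Type*} [DiffeologicalSpace P] [DiffeologicalSpace M]

/-- A connection on an `ΩG`-bundle: an `Ω𝔤`-valued 1-form on the total space. -/
abbrev LoopConnection (B : PrincipalBundle (LoopGroup d G) P M) :=
  B.Connection (loopAd (d := d) (G := G)) (loopMaurerCartan d G)

/-- `γ⁻¹∂γ : S¹ → 𝔤`, for a loop `γ : S¹ → G`. -/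
def LoopGroup.logDeriv (γ : LoopGroup d G) (θ : Real.Angle) : Eu d :=
  logDer d (fun t : ℝ => γ (θ + t)) 0 1

/-- A Higgs field on an `ΩG`-bundle: a smooth map `Φ` from the total space to the smooth maps
`S¹ → 𝔤` with `Φ(p γ) = Ad(γ⁻¹) Φ(p) + γ⁻¹∂γ`. -/
structure HiggsField (B : PrincipalBundle (LoopGroup d G) P M) where
  toFun : P → LAlg d
  smooth : DSmooth toFun
  equivariant : ∀ (p : P) (γ : LoopGroup d G) (θ : Real.Angle),
    (toFun (B.act p γ) : Real.Angle → Eu d) θ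
      = Ad d (γ θ)⁻¹ ((toFun p : Real.Angle → Eu d) θ) + γ.logDeriv θ

/-- The 1-form `dθ` on the circle, along `θ : ℝⁿ → S¹`: the derivative of the representative of
`θ(y) - θ(x)` in `(-π, π]`. -/
def dAngle {n : ℕ} (θ : Eu n → Real.Angle) (x : Eu n) : Eu n →L[ℝ] ℝ :=
  fderiv ℝ (fun y => (θ y - θ x).toReal) x

theorem dAngle_eq {n : ℕ} {θ : Eu n → Real.Angle} {τ : Eu n → ℝ} {x : Eu n}
    (e : θ =ᶠ[𝓝 x] fun y => (τ y : Real.Angle)) (hτ : ContinuousAt τ x) :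
    dAngle θ x = fderiv ℝ τ x := by
  have h : (fun y => (θ y - θ x).toReal) =ᶠ[𝓝 x] fun y => τ y - τ x := by
    have h1 : ∀ᶠ y in 𝓝 x, dist (τ y) (τ x) < Real.pi :=
      Metric.tendsto_nhds.1 hτ _ Real.pi_pos
    filter_upwards [e, h1] with y hy h1
    rw [hy, e.self_of_nhds, ← Real.Angle.coe_sub, Real.Angle.toReal_coe_eq_self_iff]
    rw [Real.dist_eq, abs_lt] at h1
    exact ⟨h1.1, h1.2.le⟩
  unfold dAngle
  rw [h.fderiv_eq, fderiv_sub_const]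

section Eval

variable {n : ℕ}

theorem contDiffAt_eval (ξ : Eu n → Real.Angle → Eu d)
    (hξ : ∀ x t, ContDiffAt ℝ ∞ (fun z : Eu n × ℝ => ξ z.1 z.2) (x, t))
    {θ : Eu n → Real.Angle} (hθ : IsPlot θ) (x : Eu n) :
    ContDiffAt ℝ ∞ (fun y => ξ y (θ y)) x := by
  obtain ⟨τ, hτ, e⟩ := exists_angle_lift hθ x
  have h : ContDiffAt ℝ ∞ (fun y => ξ y (τ y)) x :=
    ContDiffAt.comp (g := fun z : Eu n × ℝ => ξ z.1 z.2) (f := fun y => (y, τ y)) x (hξ _ _)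
      (contDiff_id.prodMk hτ).contDiffAt
  refine h.congr_of_eventuallyEq ?_
  filter_upwards [e] with y hy using by rw [hy]

/-- The logarithmic derivative of `y ↦ γ_y(θ(y))`. -/
theorem logDer_loop_eval {γ : Eu n → LoopGroup d G} (hγ : IsPlot γ)
    {θ : Eu n → Real.Angle} (hθ : IsPlot θ) (x v : Eu n) :
    logDer d (fun y => γ y (θ y)) x v = logDer d (fun y => γ y (θ x)) x v
      + dAngle θ x v • (γ x).logDeriv (θ x) := by
  obtain ⟨τ, hτ, e⟩ := exists_angle_lift hθ x
  have e1 : (fun y => γ y (θ y)) =ᶠ[𝓝 x] fun y => γ y (τ y) := by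
    filter_upwards [e] with y hy using by rw [hy]
  have h1 := logDer_diag (LoopGroup.isPlot_iff.1 hγ) (hτ.contDiffAt (x := x)) v
  rw [logDer_congr e1, dAngle_eq e hτ.continuous.continuousAt, e.self_of_nhds]
  refine h1.trans ?_
  congr 2
  have h2 := logDer_comp (d := d) (V := ℝ) (g := fun s : ℝ => γ x (s : Real.Angle))
    (f := fun t : ℝ => τ x + t) (x := 0) ((γ x).smooth _) (by fun_prop) 1
  have h3 : HasDerivAt (fun t : ℝ => τ x + t) 1 0 := (hasDerivAt_id 0).const_add _
  rw [fderiv_apply_one_eq_deriv, h3.deriv, add_zero] at h2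
  rw [← h2]
  unfold LoopGroup.logDeriv
  congr 2

end Eval

/-- The 1-form `Ã = Ad(g⁻¹) A(θ) + Θ + Ad(g⁻¹) Φ dθ` on `P × G × S¹`. -/
def caloronPreform {B : PrincipalBundle (LoopGroup d G) P M} (A : LoopConnection B)
    (Φ : HiggsField B) : OneForm (P × G × Real.Angle) (Eu d) where
  toFun r hr x :=
    { toFun := fun v =>
        Ad d (r x).2.1⁻¹
            ((A.form.toFun (fun y => (r y).1) hr.1 x v : Real.Angle → Eu d) (r x).2.2)
          + logDer d (fun y => (r y).2.1) x v
          + dAngle (fun y => (r y).2.2) x v •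
              Ad d (r x).2.1⁻¹ ((Φ.toFun (r x).1 : Real.Angle → Eu d) (r x).2.2)
      map_add' := fun v w => by
        simp only [map_add, Submodule.coe_add, Pi.add_apply, add_smul]
        abel
      map_smul' := fun c v => by
        simp only [map_smul, Submodule.coe_smul, Pi.smul_apply, smul_eq_mul, mul_smul, smul_add,
          RingHom.id_apply] }
  smooth {n} r hr v := by
    refine ContDiff.isPlot (contDiff_iff_contDiffAt.2 fun x => ?_)
    have hg : ∀ x, ContMDiffAt 𝓘(ℝ, Eu n) (𝓡 d) ∞ (fun y => (r y).2.1) x := hr.2.1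
    have hθ : IsPlot (fun y => (r y).2.2) := hr.2.2
    have h1 := contDiffAt_Ad (hg x).inv (contDiffAt_eval
      (fun y => (A.form.toFun (fun y => (r y).1) hr.1 y v : Real.Angle → Eu d))
      (A.form.smooth _ hr.1 v) hθ x)
    have h2 := contDiffAt_Ad (hg x).inv (contDiffAt_eval
      (fun y => (Φ.toFun (r y).1 : Real.Angle → Eu d)) (Φ.smooth _ _ hr.1) hθ x)
    have h3 : ContDiffAt ℝ ∞ (fun y => logDer d (fun y => (r y).2.1) y v) x :=
      ((maurerCartan d G).smooth _ hr.2.1 v).contDiff.contDiffAt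
    have h4 : ContDiffAt ℝ ∞ (fun y => dAngle (fun y => (r y).2.2) y v) x := by
      obtain ⟨τ, hτ, e⟩ := exists_angle_lift hθ x
      have : (fun y => dAngle (fun y => (r y).2.2) y v) =ᶠ[𝓝 x] fun y => fderiv ℝ τ y v := by
        filter_upwards [e.eventually_nhds] with y hy
        rw [dAngle_eq hy hτ.continuous.continuousAt]
      exact ((hτ.fderiv_right (m := ∞) (by simp)).clm_apply contDiff_const).contDiffAt
        |>.congr_of_eventuallyEq this
    exact (h1.add h3).add (h4.smul h2)
  reparam {m n} r hr f hf x v := by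
    have hg : ContMDiffAt 𝓘(ℝ, Eu m) (𝓡 d) ∞ (fun y => (r y).2.1) (f x) := hr.2.1 (f x)
    have h1 := A.form.reparam _ hr.1 f hf x v
    have h2 := logDer_comp hg (hf.contDiffAt.differentiableAt (by simp)) v
    have h3 : dAngle (fun y => (r (f y)).2.2) x v
        = dAngle (fun y => (r y).2.2) (f x) (fderiv ℝ f x v) := by
      obtain ⟨τ, hτ, e⟩ := exists_angle_lift (θ := fun y => (r y).2.2) hr.2.2 (f x)
      have e' : (fun y => (r (f y)).2.2) =ᶠ[𝓝 x] fun y => ((τ ∘ f) y : Real.Angle) :=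
        hf.continuous.continuousAt.eventually e
      rw [dAngle_eq e hτ.continuous.continuousAt,
        dAngle_eq e' (hτ.comp hf).continuous.continuousAt, fderiv_comp x
          (hτ.contDiffAt.differentiableAt (by simp)) (hf.contDiffAt.differentiableAt (by simp))]
      rfl
    exact congrArg₂ (· + ·) (congrArg₂ (· + ·)
      (congrArg (fun ξ : OmegaAlg d => Ad d (r (f x)).2.1⁻¹
        ((ξ : Real.Angle → Eu d) (r (f x)).2.2)) h1) h2)
      (congrArg (fun c : ℝ => c • Ad d (r (f x)).2.1⁻¹
        ((Φ.toFun (r (f x)).1 : Real.Angle → Eu d) (r (f x)).2.2)) h3)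

/-- The action `(p, g, θ) γ = (p γ, γ(θ)⁻¹ g, θ)` of `ΩG` on `P × G × S¹`: the orbit relation. -/
def caloronSetoid (B : PrincipalBundle (LoopGroup d G) P M) : Setoid (P × G × Real.Angle) where
  r a b := ∃ γ : LoopGroup d G, b = (B.act a.1 γ, (γ a.2.2)⁻¹ * a.2.1, a.2.2)
  iseqv :=
    { refl := fun a => ⟨1, by simp [B.act_one]⟩
      symm := by
        rintro a b ⟨γ, rfl⟩
        exact ⟨γ⁻¹, by simp [← B.act_mul, B.act_one]⟩
      trans := by
        rintro a b c ⟨γ, rfl⟩ ⟨δ, rfl⟩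
        exact ⟨γ * δ, by simp [B.act_mul, mul_assoc]⟩ }

/-- The total space `P̃ = (P × G × S¹)/ΩG` of the caloron transform. -/
def CaloronSpace (B : PrincipalBundle (LoopGroup d G) P M) : Type _ :=
  Quotient (caloronSetoid B)

/-- The class `[p, g, θ]`. -/
def caloronMk (B : PrincipalBundle (LoopGroup d G) P M) (z : P × G × Real.Angle) :
    CaloronSpace B := Quotient.mk (caloronSetoid B) z

theorem caloronMk_eq_iff (B : PrincipalBundle (LoopGroup d G) P M) {a b : P × G × Real.Angle} :
    caloronMk B a = caloronMk B b ↔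
      ∃ γ : LoopGroup d G, b = (B.act a.1 γ, (γ a.2.2)⁻¹ * a.2.1, a.2.2) :=
  Quotient.eq (r := caloronSetoid B)

theorem caloronMk_surjective (B : PrincipalBundle (LoopGroup d G) P M) :
    Function.Surjective (caloronMk B) := Quotient.mk_surjective

instance (B : PrincipalBundle (LoopGroup d G) P M) : DiffeologicalSpace (CaloronSpace B) :=
  quotientDiffeology (caloronMk B) (caloronMk_surjective B)

/-- Two smooth families in `P` with the same projection differ by a smooth family in `ΩG`. -/
theorem exists_isPlot_div (B : PrincipalBundle (LoopGroup d G) P M) {n : ℕ} {p q : Eu n → P}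
    (hp : IsPlot p) (hq : IsPlot q) (h : ∀ y, B.proj (p y) = B.proj (q y)) (x : Eu n) :
    ∃ γ : Eu n → LoopGroup d G, IsPlot γ ∧ ∀ᶠ y in 𝓝 x, q y = B.act (p y) (γ y) := by
  obtain ⟨U, s, φ, hU, hx, h1, h2, h3, h4, h5⟩ := B.locally_trivial (B.proj (p x))
  have ho : IsOpen ((fun y => B.proj (p y)) ⁻¹' U) :=
    isOpen_iff_preimages_plots.1 hU n _ (B.smooth_proj n p hp)
  obtain ⟨f, hf, hfu, hfx⟩ := exists_retract ho hx
  have hp' : IsPlot (fun y => φ (p (f y))) := h5 _ (isPlot_reparam hp hf) fun z => hfu z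
  have hq' : IsPlot (fun y => φ (q (f y))) := h5 _ (isPlot_reparam hq hf) fun z => by
    rw [← h]; exact hfu z
  refine ⟨fun y => (φ (p (f y)))⁻¹ * φ (q (f y)),
    LoopGroup.isPlot_mul (LoopGroup.isPlot_inv hp') hq', ?_⟩
  filter_upwards [hfx] with y hy
  have hyU : B.proj (p y) ∈ U := by have := hfu y; rwa [hy] at this
  rw [hy]
  have h6 := h2 (p y) hyU
  have h7 := h2 (q y) (h y ▸ hyU)
  rw [← h] at h7
  calc q y = B.act (B.act (s (B.proj (p y))) (φ (p y))) ((φ (p y))⁻¹ * φ (q y)) := by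
        rw [← B.act_mul, mul_inv_cancel_left, h7]
    _ = _ := by rw [h6]

/-- The 1-form `Ã` on `P × G × S¹` is basic for the action of `ΩG`. -/
theorem caloronPreform_basic {B : PrincipalBundle (LoopGroup d G) P M} (A : LoopConnection B)
    (Φ : HiggsField B) {n : ℕ} (r s : Eu n → P × G × Real.Angle) (hr : IsPlot r) (hs : IsPlot s)
    (x : Eu n) (h : ∀ y, caloronMk B (r y) = caloronMk B (s y)) :
    (caloronPreform A Φ).toFun r hr x = (caloronPreform A Φ).toFun s hs x := by
  have h' := fun y => (caloronMk_eq_iff B).1 (h y)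
  obtain ⟨γ, hγ, hγx⟩ := exists_isPlot_div B hr.1 hs.1 (fun y => by
    obtain ⟨δ, hδ⟩ := h' y
    rw [hδ, B.proj_act]) x
  have hev : s =ᶠ[𝓝 x] fun y => (B.act (r y).1 (γ y), (γ y (r y).2.2)⁻¹ * (r y).2.1, (r y).2.2) := by
    filter_upwards [hγx] with y hy
    obtain ⟨δ, hδ⟩ := h' y
    have : δ = γ y := by
      refine B.act_injective (p := (r y).1) ?_
      rw [← hy, hδ]
    rw [hδ, this]
  have hs' : IsPlot (fun y => (B.act (r y).1 (γ y), (γ y (r y).2.2)⁻¹ * (r y).2.1, (r y).2.2)) :=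
    ⟨B.isPlot_act hr.1 hγ, fun y => (LoopGroup.contMDiffAt_eval hγ hr.2.2 y).inv.mul (hr.2.1 y),
      hr.2.2⟩
  rw [(caloronPreform A Φ).toFun_congr hs hs' hev]
  ext1 v
  have hg : ContMDiffAt 𝓘(ℝ, Eu n) (𝓡 d) ∞ (fun y => (r y).2.1) x := hr.2.1 x
  have hγθ := LoopGroup.contMDiffAt_eval hγ hr.2.2 x
  have k1 := A.toFun_act _ hr.1 γ hγ x v
  have k2 := congrArg (fun L => L v) (logDer_mul hγθ.inv hg)
  have k3 := congrArg (fun L => L v) (logDer_mul hγθ hγθ.inv)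
  have k4 := logDer_loop_eval hγ hr.2.2 x v
  have k5 := Φ.equivariant (r x).1 (γ x) (r x).2.2
  simp only [mul_inv_cancel, logDer_const, inv_inv] at k3
  change Ad d (r x).2.1⁻¹ ((A.form.toFun (fun y => (r y).1) hr.1 x v : Real.Angle → Eu d)
      (r x).2.2) + logDer d (fun y => (r y).2.1) x v + dAngle (fun y => (r y).2.2) x v •
      Ad d (r x).2.1⁻¹ ((Φ.toFun (r x).1 : Real.Angle → Eu d) (r x).2.2)
    = Ad d ((γ x (r x).2.2)⁻¹ * (r x).2.1)⁻¹
        ((A.form.toFun (fun y => B.act (r y).1 (γ y)) hs'.1 x v : Real.Angle → Eu d) (r x).2.2)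
      + logDer d (fun y => (γ y (r y).2.2)⁻¹ * (r y).2.1) x v
      + dAngle (fun y => (r y).2.2) x v • Ad d ((γ x (r x).2.2)⁻¹ * (r x).2.1)⁻¹
        ((Φ.toFun (B.act (r x).1 (γ x)) : Real.Angle → Eu d) (r x).2.2)
  have hAd : Ad d ((γ x (r x).2.2)⁻¹ * (r x).2.1)⁻¹
      = (Ad d (r x).2.1⁻¹).comp (Ad d (γ x (r x).2.2)) := by
    rw [mul_inv_rev, inv_inv, Ad_mul]
  have hcan : ∀ ξ : Eu d, Ad d (γ x (r x).2.2) (Ad d (γ x (r x).2.2)⁻¹ ξ) = ξ := fun ξ => by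
    have := Ad_inv_comp (d := d) (γ x (r x).2.2)⁻¹
    rw [inv_inv] at this
    exact congrArg (fun L => L ξ) this
  have k1' : (A.form.toFun (fun y => B.act (r y).1 (γ y)) hs'.1 x v : Real.Angle → Eu d) (r x).2.2
      = Ad d (γ x (r x).2.2)⁻¹ ((A.form.toFun (fun y => (r y).1) hr.1 x v : Real.Angle → Eu d)
        (r x).2.2) + logDer d (fun y => γ y (r x).2.2) x v :=
    congrArg (fun ξ : OmegaAlg d => (ξ : Real.Angle → Eu d) (r x).2.2) k1
  have k2' : logDer d (fun y => (γ y (r y).2.2)⁻¹ * (r y).2.1) x v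
      = Ad d (r x).2.1⁻¹ (logDer d (fun y => (γ y (r y).2.2)⁻¹) x v)
        + logDer d (fun y => (r y).2.1) x v := k2
  have k3' : (0 : Eu d) = Ad d (γ x (r x).2.2) (logDer d (fun y => γ y (r y).2.2) x v)
      + logDer d (fun y => (γ y (r y).2.2)⁻¹) x v := k3
  have k3'' := eq_neg_of_add_eq_zero_right k3'.symm
  rw [hAd, k1', k2', k3'', k4, k5]
  simp only [ContinuousLinearMap.comp_apply, map_add, map_neg, map_smul, hcan, smul_add]
  abel

theorem caloron_lift (B : PrincipalBundle (LoopGroup d G) P M) {n : ℕ}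
    (q : Eu n → CaloronSpace B) (hq : IsPlot q) (x : Eu n) :
    ∃ r : Eu n → P × G × Real.Angle, IsPlot r ∧ q =ᶠ[𝓝 x] fun y => caloronMk B (r y) := hq x

theorem isPlot_caloronMk (B : PrincipalBundle (LoopGroup d G) P M) {n : ℕ}
    {r : Eu n → P × G × Real.Angle} (hr : IsPlot r) : IsPlot (fun y => caloronMk B (r y)) :=
  fun _ => ⟨r, hr, Filter.EventuallyEq.rfl⟩

/-- `[p, g, θ] ↦ (proj p, θ)`. -/
def caloronProj (B : PrincipalBundle (LoopGroup d G) P M) : CaloronSpace B → M × Real.Angle :=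
  Quotient.lift (fun z : P × G × Real.Angle => (B.proj z.1, z.2.2)) (by
    rintro a b ⟨γ, rfl⟩
    simp [B.proj_act])

/-- `[p, g, θ] h = [p, g h, θ]`. -/
def caloronAct (B : PrincipalBundle (LoopGroup d G) P M) (q : CaloronSpace B) (h : G) :
    CaloronSpace B :=
  Quotient.map (sa := caloronSetoid B) (sb := caloronSetoid B)
    (fun z : P × G × Real.Angle => (z.1, z.2.1 * h, z.2.2)) (by
    rintro a b ⟨γ, rfl⟩
    exact ⟨γ, by simp [mul_assoc]⟩) q

/-- The caloron transform of an `ΩG`-bundle over `M`, a `G`-bundle over `M × S¹`. -/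
def caloronTransform (B : PrincipalBundle (LoopGroup d G) P M) :
    PrincipalBundle G (CaloronSpace B) (M × Real.Angle) where
  proj := caloronProj B
  act := caloronAct B
  act_one q := by
    obtain ⟨z, rfl⟩ := caloronMk_surjective B q
    change caloronMk B (z.1, z.2.1 * 1, z.2.2) = caloronMk B z
    rw [mul_one]
  act_mul q a b := by
    obtain ⟨z, rfl⟩ := caloronMk_surjective B q
    change caloronMk B (z.1, z.2.1 * (a * b), z.2.2) = caloronMk B (z.1, z.2.1 * a * b, z.2.2)
    rw [mul_assoc]
  proj_act q g := by
    obtain ⟨z, rfl⟩ := caloronMk_surjective B q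
    rfl
  smooth_proj n q hq := isPlot_of_locally fun x => by
    obtain ⟨r, hr, e⟩ := caloron_lift B q hq x
    refine ⟨fun y => (B.proj (r y).1, (r y).2.2), ⟨B.smooth_proj n _ hr.1, hr.2.2⟩, ?_⟩
    filter_upwards [e] with y hy
    rw [Function.comp_apply, hy]
    rfl
  smooth_act n qg hqg := isPlot_of_locally fun x => by
    obtain ⟨r, hr, e⟩ := caloron_lift B _ hqg.1 x
    refine ⟨fun y => caloronMk B ((r y).1, (r y).2.1 * (qg y).2, (r y).2.2),
      isPlot_caloronMk B ⟨hr.1, fun y => (hr.2.1 y).mul (hqg.2 y), hr.2.2⟩, ?_⟩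
    filter_upwards [e] with y hy
    rw [Function.comp_apply, hy]
    rfl
  locally_trivial := by
    rintro ⟨m, θ⟩
    obtain ⟨U, s, φ, hU, hm, h1, h2, h3, h4, h5⟩ := B.locally_trivial m
    have hφ : ∀ p γ, B.proj p ∈ U → φ (B.act p γ) = φ p * γ := by
      intro p γ hp
      have h6 := h2 p hp
      conv_lhs => rw [← h6]
      rw [← B.act_mul, h3 _ hp]
    let Φ : CaloronSpace B → G := fun q =>
      φ (Quotient.out q).1 (Quotient.out q).2.2 * (Quotient.out q).2.1
    have hΦ : ∀ z : P × G × Real.Angle, B.proj z.1 ∈ U →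
        Φ (caloronMk B z) = φ z.1 z.2.2 * z.2.1 := by
      intro z hz
      have h6 : caloronMk B z = caloronMk B (Quotient.out (caloronMk B z)) :=
        (Quotient.out_eq (caloronMk B z)).symm
      obtain ⟨γ, hγ⟩ := (caloronMk_eq_iff B).1 h6
      simp only [Φ, hγ]
      rw [hφ _ _ hz, LoopGroup.mul_apply, mul_assoc, mul_inv_cancel_left]
    refine ⟨{x | x.1 ∈ U}, fun x => caloronMk B (s x.1, 1, x.2), Φ, ?_, hm, ?_, ?_, ?_, ?_, ?_⟩
    · exact isOpen_iff_preimages_plots.2 fun n p hp =>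
        isOpen_iff_preimages_plots.1 hU n _ hp.1
    · intro y hy
      exact Prod.ext (h1 _ hy) rfl
    · intro q hq
      obtain ⟨z, rfl⟩ := caloronMk_surjective B q
      change B.proj z.1 ∈ U at hq
      rw [hΦ z hq]
      change caloronMk B (s (B.proj z.1), 1 * (φ z.1 z.2.2 * z.2.1), z.2.2) = _
      refine (caloronMk_eq_iff B).2 ⟨φ z.1, ?_⟩
      rw [h2 _ hq]
      simp
    · intro y hy g
      have h7 : B.proj (s y.1) ∈ U := by rw [h1 _ hy]; exact hy
      have h6 := hΦ (s y.1, 1 * g, y.2) h7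
      refine h6.trans ?_
      have := h3 y.1 hy 1
      rw [B.act_one] at this
      simp [this]
    · intro n q hq hqU
      exact isPlot_caloronMk B ⟨h4 _ hq.1 hqU, isPlot_const, hq.2⟩
    · intro n q hq hqU
      refine isPlot_of_locally fun x => ?_
      obtain ⟨r, hr, e⟩ := caloron_lift B q hq x
      obtain ⟨u, hu, huo, hxu⟩ := eventually_nhds_iff.1 e
      obtain ⟨f, hf, hfu, hfx⟩ := exists_retract huo hxu
      have hrU : ∀ y, B.proj (r (f y)).1 ∈ U := fun y => by
        have := hqU (f y)
        rw [hu _ (hfu y)] at this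
        exact this
      have hp := h5 _ (isPlot_reparam hr.1 hf) hrU
      refine ⟨fun y => φ (r (f y)).1 (r (f y)).2.2 * (r (f y)).2.1, fun y =>
        (LoopGroup.contMDiffAt_eval hp (isPlot_reparam hr.2.2 hf) y).mul
          (isPlot_reparam hr.2.1 hf y), ?_⟩
      filter_upwards [hfx] with y hy
      have h8 := hΦ (r (f y)) (hrU y)
      have h9 : q y = caloronMk B (r (f y)) := by
        have := hu _ (hfu y)
        rw [hy] at this ⊢
        exact this
      rw [h9]
      exact h8

/-- The 1-form `Ã = Ad(g⁻¹) A(θ) + Θ + Ad(g⁻¹) Φ dθ` on `P̃ = (P × G × S¹)/ΩG`. -/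
def caloronForm {B : PrincipalBundle (LoopGroup d G) P M} (A : LoopConnection B)
    (Φ : HiggsField B) : OneForm (CaloronSpace B) (Eu d) :=
  (caloronPreform A Φ).descend (caloronMk B) (caloron_lift B)
    (fun r s hr hs x h => caloronPreform_basic A Φ r s hr hs x h)

theorem caloronForm_toFun {B : PrincipalBundle (LoopGroup d G) P M} (A : LoopConnection B)
    (Φ : HiggsField B) {n : ℕ} (q : Eu n → CaloronSpace B) (hq : IsPlot q)
    (r : Eu n → P × G × Real.Angle) (hr : IsPlot r) (x : Eu n)
    (e : q =ᶠ[𝓝 x] fun y => caloronMk B (r y)) :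
    (caloronForm A Φ).toFun q hq x = (caloronPreform A Φ).toFun r hr x :=
  OneForm.descend_toFun _ _ _ _ _ hq _ hr x e

theorem dAngle_const {n : ℕ} (θ : Real.Angle) (x : Eu n) : dAngle (fun _ : Eu n => θ) x = 0 := by
  unfold dAngle
  exact (hasFDerivAt_const _ x).fderiv

/-- The form `Ã` is a connection on the caloron transform. -/
def caloronConnection {B : PrincipalBundle (LoopGroup d G) P M} (A : LoopConnection B)
    (Φ : HiggsField B) : GConnection d (caloronTransform B) where
  form := caloronForm A Φ
  vertical := by
    intro q n g hg x v
    obtain ⟨z, rfl⟩ := caloronMk_surjective B q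
    have hs : IsPlot (fun y => (z.1, z.2.1 * g y, z.2.2)) :=
      ⟨isPlot_const, fun y => contMDiffAt_const.mul (hg y), isPlot_const⟩
    rw [caloronForm_toFun A Φ (fun y => (caloronTransform B).act (caloronMk B z) (g y))
      _ _ hs x Filter.EventuallyEq.rfl]
    change Ad d (z.2.1 * g x)⁻¹ ((A.form.toFun (fun y => z.1) isPlot_const x v :
        Real.Angle → Eu d) z.2.2) + logDer d (fun y => z.2.1 * g y) x v
      + dAngle (fun y => z.2.2) x v • Ad d (z.2.1 * g x)⁻¹
        ((Φ.toFun z.1 : Real.Angle → Eu d) z.2.2) = logDer d g x v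
    rw [A.form.toFun_const, dAngle_const, logDer_mul contMDiffAt_const (hg x), logDer_const]
    simp
  equivariant := by
    intro n q hq g x v
    obtain ⟨r, hr, e⟩ := caloron_lift B q hq x
    have hs : IsPlot (fun y => ((r y).1, (r y).2.1 * g, (r y).2.2)) :=
      ⟨hr.1, fun y => (hr.2.1 y).mul contMDiffAt_const, hr.2.2⟩
    have hg : ContMDiffAt 𝓘(ℝ, Eu n) (𝓡 d) ∞ (fun y => (r y).2.1) x := hr.2.1 x
    rw [caloronForm_toFun A Φ _ _ _ hr x e,
      caloronForm_toFun A Φ _ _ _ hs x (by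
        filter_upwards [e] with y hy
        rw [hy]
        rfl)]
    change Ad d ((r x).2.1 * g)⁻¹ ((A.form.toFun (fun y => (r y).1) hr.1 x v :
        Real.Angle → Eu d) (r x).2.2) + logDer d (fun y => (r y).2.1 * g) x v
      + dAngle (fun y => (r y).2.2) x v • Ad d ((r x).2.1 * g)⁻¹
        ((Φ.toFun (r x).1 : Real.Angle → Eu d) (r x).2.2)
      = Ad d g⁻¹ (Ad d (r x).2.1⁻¹ ((A.form.toFun (fun y => (r y).1) hr.1 x v :
        Real.Angle → Eu d) (r x).2.2) + logDer d (fun y => (r y).2.1) x v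
      + dAngle (fun y => (r y).2.2) x v • Ad d (r x).2.1⁻¹
        ((Φ.toFun (r x).1 : Real.Angle → Eu d) (r x).2.2))
    rw [logDer_mul hg contMDiffAt_const, logDer_const, mul_inv_rev, Ad_mul]
    simp

end Caloron

/-! ### Holonomy -/

section Holonomy

variable {d : ℕ} {G : Type*} [TopologicalSpace G] [ChartedSpace (Eu d) G] [Group G]
  [LieGroup (𝓡 d) ∞ G] {P Q M : Type*} [DiffeologicalSpace P] [DiffeologicalSpace Q]
  [DiffeologicalSpace M]

/-- A framing of a `G`-bundle over `M × S¹`: a smooth section over `M₀ = M × {0}`. -/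
structure Framing {G : Type*} [Group G] [DiffeologicalSpace G]
    (B : PrincipalBundle G Q (M × Real.Angle)) where
  sec : M → Q
  smooth : DSmooth sec
  proj_sec : ∀ m, B.proj (sec m) = (m, 0)

theorem caloronMk_framing (B : PrincipalBundle (LoopGroup d G) P M) {p q : P}
    (h : B.proj p = B.proj q) : caloronMk B (p, (1 : G), 0) = caloronMk B (q, (1 : G), 0) := by
  obtain ⟨γ, rfl⟩ := B.exists_act_eq h
  exact (caloronMk_eq_iff B).2 ⟨γ, by simp [γ.map_zero]⟩

theorem exists_framing_lift (B : PrincipalBundle (LoopGroup d G) P M) {n : ℕ} (q : Eu n → M)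
    (hq : IsPlot q) (x : Eu n) : ∃ p : Eu n → P, IsPlot p ∧ ∀ᶠ y in 𝓝 x, B.proj (p y) = q y := by
  obtain ⟨U, s, φ, hU, hm, h1, -, -, h4, -⟩ := B.locally_trivial (q x)
  obtain ⟨f, hf, hfu, hfx⟩ := exists_retract (isOpen_iff_preimages_plots.1 hU n q hq) hm
  refine ⟨fun y => s (q (f y)), h4 _ (isPlot_reparam hq hf) hfu, ?_⟩
  filter_upwards [hfx] with y hy
  rw [h1 _ (hfu y), hy]

/-- The framing `s₀(m, 0) = [p, 1, 0]`, with `p` any point over `m`, of the caloron transform. -/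
def caloronFraming (B : PrincipalBundle (LoopGroup d G) P M) : Framing (caloronTransform B) where
  sec m := caloronMk B (Function.surjInv B.proj_surjective m, 1, 0)
  smooth n q hq := isPlot_of_locally fun x => by
    obtain ⟨p, hp, e⟩ := exists_framing_lift B q hq x
    refine ⟨fun y => caloronMk B (p y, 1, 0),
      isPlot_caloronMk B ⟨hp, isPlot_const, isPlot_const⟩, ?_⟩
    filter_upwards [e] with y hy
    exact caloronMk_framing B (by rw [hy]; exact Function.surjInv_eq B.proj_surjective _)
  proj_sec m := Prod.ext (Function.surjInv_eq B.proj_surjective m) rfl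

/-- The framing of the caloron transform does not depend on the choice of the point `p`. -/
theorem caloronFraming_proj (B : PrincipalBundle (LoopGroup d G) P M) (p : P) :
    (caloronFraming B).sec (B.proj p) = caloronMk B (p, 1, 0) :=
  caloronMk_framing B (Function.surjInv_eq B.proj_surjective _)

/-- The caloron connection is framed: its pullback along the framing vanishes. -/
theorem caloronConnection_framed {B : PrincipalBundle (LoopGroup d G) P M} (A : LoopConnection B)
    (Φ : HiggsField B) {n : ℕ} (q : Eu n → M) (hq : IsPlot q) (x : Eu n) :
    (caloronConnection A Φ).form.toFun (fun y => (caloronFraming B).sec (q y))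
      ((caloronFraming B).smooth n q hq) x = 0 := by
  obtain ⟨p, hp, e⟩ := exists_framing_lift B q hq x
  have hr : IsPlot (fun y => (p y, (1 : G), (0 : Real.Angle))) := ⟨hp, isPlot_const, isPlot_const⟩
  have h := caloronForm_toFun A Φ (fun y => (caloronFraming B).sec (q y))
    ((caloronFraming B).smooth n q hq) _ hr x (by
      filter_upwards [e] with y hy
      rw [← hy, caloronFraming_proj])
  refine h.trans ?_
  ext1 v
  change Ad d (1 : G)⁻¹ ((A.form.toFun p hp x v : Real.Angle → Eu d) 0)
      + logDer d (fun _ => (1 : G)) x v + dAngle (fun _ => 0) x v •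
      Ad d (1 : G)⁻¹ ((Φ.toFun (p x) : Real.Angle → Eu d) 0) = 0
  rw [(A.form.toFun p hp x v).2.2, dAngle_const, logDer_const]
  simp

/-- `Ω_{M₀}(M × S¹)`: the smooth loops in `M × S¹` that start in `M₀ = M × {0}`. -/
def BaseLoops (M : Type*) [DiffeologicalSpace M] : Type _ :=
  {γ : Real.Angle → M × Real.Angle // DSmooth γ ∧ (γ 0).2 = 0}

/-- `Ω_{Q₀}(Q)`: the smooth loops in `Q` that start in the image `Q₀` of the framing. -/
def TotalLoops {B : PrincipalBundle G Q (M × Real.Angle)} (s : Framing B) : Type _ :=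
  {γ : Real.Angle → Q // DSmooth γ ∧ γ 0 ∈ Set.range s.sec}

/-- The projection `Ω_{Q₀}(Q) → Ω_{M₀}(M × S¹)`. -/
def TotalLoops.proj {B : PrincipalBundle G Q (M × Real.Angle)} {s : Framing B}
    (γ : TotalLoops s) : BaseLoops M :=
  ⟨fun θ => B.proj (γ.1 θ), B.smooth_proj.comp γ.2.1, by
    obtain ⟨m, hm⟩ := γ.2.2
    change (B.proj (γ.1 0)).2 = 0
    rw [← hm, s.proj_sec]⟩

/-- `η(m)(θ) = (m, θ)`. -/
def eta (m : M) : BaseLoops M :=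
  ⟨fun θ => (m, θ), fun _ _ hp => ⟨isPlot_const, hp⟩, rfl⟩

/-- `η̂(p)(θ) = [p, 1, θ]`. -/
def etaHat (B : PrincipalBundle (LoopGroup d G) P M) (p : P) : TotalLoops (caloronFraming B) :=
  ⟨fun θ => caloronMk B (p, 1, θ), fun _ _ hθ =>
    isPlot_caloronMk B ⟨isPlot_const, isPlot_const, hθ⟩, B.proj p, caloronFraming_proj B p⟩

/-- `c` is the horizontal lift of the loop `γ` that starts in the framing. -/
def IsHorizontalLift {B : PrincipalBundle G Q (M × Real.Angle)} (s : Framing B)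
    (A : GConnection d B) (γ : BaseLoops M) (c : ℝ → Q) : Prop :=
  c 0 = s.sec (γ.1 0).1 ∧ (∀ t : ℝ, B.proj (c t) = γ.1 t) ∧
    ∃ hc : DSmooth c, ∀ t, A.form.onCurve c hc t = 0

open Classical in
/-- The horizontal lift `γ_h` of the loop `γ` that starts in the framing (a constant curve if
there is no such lift). -/
def horizontalLift {B : PrincipalBundle G Q (M × Real.Angle)} (s : Framing B)
    (A : GConnection d B) (γ : BaseLoops M) : ℝ → Q :=
  if h : ∃ c, IsHorizontalLift s A γ c then h.choose else fun _ => s.sec (γ.1 0).1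

/-- The holonomy `Ω_{Q₀}(Q) → PG`, determined by `γ = γ_h hol(γ)`, where `γ_h` is the horizontal
lift of the projection of `γ`. -/
def holPath {B : PrincipalBundle G Q (M × Real.Angle)} (s : Framing B)
    (A : GConnection d B) (γ : TotalLoops s) (t : ℝ) : G :=
  B.div (horizontalLift s A γ.proj t) (γ.1 t)

/-- The holonomy `Ω_{M₀}(M × S¹) → G` relative to the framing: `γ_h(0) = γ_h(2π) hol(γ)`. -/
def hol {B : PrincipalBundle G Q (M × Real.Angle)} (s : Framing B)
    (A : GConnection d B) (γ : BaseLoops M) : G :=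
  B.div (horizontalLift s A γ (2 * Real.pi)) (s.sec (γ.1 0).1)

/-- The total space `PG` of the path fibration: the smooth paths `g : ℝ → G` with `g(0) = 1`
and `g⁻¹∂g` periodic. -/
@[ext]
structure PathSpace (d : ℕ) (G : Type*) [TopologicalSpace G] [ChartedSpace (Eu d) G]
    [Group G] where
  toFun : ℝ → G
  smooth : ContMDiff 𝓘(ℝ, ℝ) (𝓡 d) ∞ toFun
  map_zero : toFun 0 = 1
  periodic : ∀ t, logDer d toFun (t + 2 * Real.pi) 1 = logDer d toFun t 1

/-- `g` solves `g⁻¹∂g = Φ(p)`. -/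
def HiggsField.IsSolution {B : PrincipalBundle (LoopGroup d G) P M} (Φ : HiggsField B) (p : P)
    (g : PathSpace d G) : Prop :=
  ∀ t : ℝ, logDer d g.toFun t 1 = (Φ.toFun p : Real.Angle → Eu d) t

open Classical in
/-- The Higgs field holonomy `hol_Φ(p)` in `PG`: the solution `g` of `g⁻¹∂g = Φ(p)` (the constant
path if there is no solution). -/
def HiggsField.holPath {B : PrincipalBundle (LoopGroup d G) P M} (Φ : HiggsField B) (p : P) :
    PathSpace d G :=
  if h : ∃ g, Φ.IsSolution p g then h.choose else
    ⟨fun _ => 1, contMDiff_const, rfl, fun t => by rw [logDer_const, logDer_const]⟩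

/-- The Higgs field holonomy `hol_Φ : M → G`: the value at `2π` of `hol_Φ(p)`, for a point `p`
over `m`. -/
def HiggsField.hol {B : PrincipalBundle (LoopGroup d G) P M} (Φ : HiggsField B) (m : M) : G :=
  (Φ.holPath (Function.surjInv B.proj_surjective m)).toFun (2 * Real.pi)

end Holonomy

end Caloron

end

namespace Caloron

/-! ### Paths in a Lie group with prescribed logarithmic derivative -/

section LogPrimitive

variable {d : ℕ} {G : Type*} [TopologicalSpace G] [ChartedSpace (Eu d) G] [Group G]

/-! Everything reduces to the equation `g⁻¹∂g = ξ` for paths in a Lie group. If `g` and `h` both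
solve it, the product rule shows that `g h⁻¹` has logarithmic derivative zero. Such a path is
locally constant, as one sees in the chart at `1`, so on an interval a solution is determined by one
value (`IsLogPrimitiveOn.eqOn`). For existence, Picard-Lindelöf in a chart gives a solution near any
time. Since `g⁻¹∂g` is left invariant, a left translation matches two solutions on an overlap, so
solutions can always be continued (`exists_isLogPrimitiveOn_univ`).

With `ξ = Φ(p)` the solution is `hol_Φ(p)`. The equivariance of the Higgs field says precisely that
`hol_Φ(p) γ` solves the equation of `pγ`, hence `hol_Φ(pγ) = hol_Φ(p) γ` (`HiggsField.holPath_act`),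
and `γ(2π) = γ(0) = 1` makes the value at `2π` a function of `π(p)`.

The bridge to the caloron transform is an explicit horizontal lift (`isHorizontalLift_eta`). With `g
= hol_Φ(p)`, the curve `t ↦ [p, g(t)⁻¹, t]` starts at `[p, 1, 0]`. Along it the term of `A` vanishes
because `p` is constant, the Maurer-Cartan term is `-Ad(g) Φ(p)`, and the `dθ` term is `Ad(g) Φ(p)`.
Two horizontal lifts differ by a path in `G` with vanishing logarithmic derivative, so this is the
only lift (`IsHorizontalLift.unique`). Acting on it by `g(t)` gives `[p, 1, t] = η̂(p)(t)`, which
identifies `g` with the holonomy of `η̂(p)`. At `t = 2π` the loop `η̂(p)` is back in the framing,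
which gives the statement on `M`. -/

theorem logDer_const_mul {W : Type*} [NormedAddCommGroup W] [NormedSpace ℝ W] (c : G) (g : W → G)
    (w : W) : logDer d (fun y => c * g y) w = logDer d g w := by
  unfold logDer
  simp [mul_assoc]

/-- On `U`, the path `g` is smooth with `g⁻¹∂g = ξ`. -/
def IsLogPrimitiveOn (ξ : ℝ → Eu d) (g : ℝ → G) (U : Set ℝ) : Prop :=
  ∀ t ∈ U, ContMDiffAt 𝓘(ℝ, ℝ) (𝓡 d) ∞ g t ∧ logDer d g t 1 = ξ t

theorem IsLogPrimitiveOn.mono {ξ : ℝ → Eu d} {g : ℝ → G} {U V : Set ℝ}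
    (h : IsLogPrimitiveOn ξ g V) (hUV : U ⊆ V) : IsLogPrimitiveOn ξ g U :=
  fun t ht => h t (hUV ht)

variable [LieGroup (𝓡 d) ∞ G]

/-- Differentiate `g g⁻¹ = 1` by the product rule. -/
theorem logDer_inv {W : Type*} [NormedAddCommGroup W] [NormedSpace ℝ W] {g : W → G} {w : W}
    (hg : ContMDiffAt 𝓘(ℝ, W) (𝓡 d) ∞ g w) :
    logDer d (fun y => (g y)⁻¹) w = -(Ad d (g w)).comp (logDer d g w) := by
  have h := logDer_mul hg hg.inv
  simp only [mul_inv_cancel, logDer_const, inv_inv] at h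
  exact eq_neg_of_add_eq_zero_right h.symm

/-- Left invariance of `g⁻¹∂g`. It allows a solution to be given any prescribed value at one time,
both for gluing and for the normalization `g(0) = 1`. -/
theorem IsLogPrimitiveOn.const_mul {ξ : ℝ → Eu d} {g : ℝ → G} {U : Set ℝ}
    (h : IsLogPrimitiveOn ξ g U) (c : G) : IsLogPrimitiveOn ξ (fun t => c * g t) U :=
  fun t ht => ⟨contMDiffAt_const.mul (h t ht).1, by rw [logDer_const_mul]; exact (h t ht).2⟩

/-- A path whose logarithmic derivative vanishes is locally constant. -/
theorem eventually_eq_of_logDer_eq_zero {k : ℝ → G} {t : ℝ}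
    (h : ∀ᶠ s in 𝓝 t, ContMDiffAt 𝓘(ℝ, ℝ) (𝓡 d) ∞ k s ∧ logDer d k s 1 = 0) :
    ∀ᶠ s in 𝓝 t, k s = k t := by
  have : IsManifold (𝓡 d) ∞ G := LieGroup.toContMDiffMul.toIsManifold
  -- Translating by `k(t)⁻¹` moves the path near `t` into the domain of the chart at `1`, where the
  -- calculus of vector-valued functions applies.
  have hsrc : ∀ᶠ s in 𝓝 t, (k t)⁻¹ * k s ∈ (extChartAt (𝓡 d) (1 : G)).source := by
    have hc := (contMDiffAt_inv_mul h.self_of_nhds.1 (k t)⁻¹).continuousAt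
    refine hc.eventually ?_
    simp only [inv_mul_cancel]
    exact extChartAt_source_mem_nhds (1 : G)
  obtain ⟨ε, hε, hb⟩ := Metric.eventually_nhds_iff_ball.1 (h.and hsrc)
  set f : ℝ → Eu d := fun s => extChartAt (𝓡 d) (1 : G) ((k t)⁻¹ * k s) with hf
  have hd : ∀ s ∈ Metric.ball t ε, HasFDerivAt f (0 : ℝ →L[ℝ] Eu d) s := by
    intro s hs
    obtain ⟨⟨h1, h2⟩, h3⟩ := hb s hs
    have hk : HasMFDerivAt 𝓘(ℝ, ℝ) (𝓡 d) (fun y => (k s)⁻¹ * k y) s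
        (mfderiv 𝓘(ℝ, ℝ) (𝓡 d) (fun y => (k s)⁻¹ * k y) s) :=
      ((contMDiffAt_inv_mul h1 (k s)⁻¹).mdifferentiableAt (by simp)).hasMFDerivAt
    have hz : (mfderiv 𝓘(ℝ, ℝ) (𝓡 d) (fun y => (k s)⁻¹ * k y) s : ℝ →L[ℝ] Eu d) = 0 := by
      ext1
      exact h2
    -- The hypothesis concerns the translate `k(s)⁻¹ k`, based at the moving time `s`, while `f`
    -- uses the fixed translate `k(t)⁻¹ k`. The smooth map `x ↦ chart(k(t)⁻¹ k(s) x)` carries the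
    -- first to `f`, so the derivative of `f` at `s` factors through zero.
    have hΨ : MDifferentiableAt (𝓡 d) 𝓘(ℝ, Eu d)
        (fun x : G => extChartAt (𝓡 d) (1 : G) ((k t)⁻¹ * k s * x)) ((k s)⁻¹ * k s) := by
      have h4 : ContMDiffAt (𝓡 d) 𝓘(ℝ, Eu d) ∞ (extChartAt (𝓡 d) (1 : G))
          ((k t)⁻¹ * k s * ((k s)⁻¹ * k s)) := by
        rw [inv_mul_cancel, mul_one]
        exact contMDiffAt_extChartAt' (by rwa [extChartAt_source] at h3)
      exact (ContMDiffAt.comp (I' := 𝓡 d) _ (g := extChartAt (𝓡 d) (1 : G)) h4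
        (contMDiffAt_const.mul contMDiffAt_id)).mdifferentiableAt (by simp)
    have hc := hΨ.hasMFDerivAt.comp s hk
    have e : (fun x : G => extChartAt (𝓡 d) (1 : G) ((k t)⁻¹ * k s * x)) ∘
        (fun y => (k s)⁻¹ * k y) = f := by
      ext1 y
      simp [hf, mul_assoc]
    rw [e] at hc
    have hc' := hasMFDerivAt_iff_hasFDerivAt.1 hc
    have h5 := (congrArg (ContinuousLinearMap.comp (mfderiv (𝓡 d) 𝓘(ℝ, Eu d) (fun x : G =>
      extChartAt (𝓡 d) (1 : G) ((k t)⁻¹ * k s * x)) ((k s)⁻¹ * k s) : Eu d →L[ℝ] Eu d)) hz).trans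
      (ContinuousLinearMap.comp_zero _)
    exact (congrArg (fun L : ℝ →L[ℝ] Eu d => HasFDerivAt f L s) h5).mp hc'
  filter_upwards [Metric.ball_mem_nhds t hε] with s hs
  have h5 : f s = f t := Metric.isOpen_ball.is_const_of_fderiv_eq_zero
    (convex_ball t ε).isPreconnected (fun y hy => (hd y hy).differentiableAt.differentiableWithinAt)
    (fun y hy => (hd y hy).fderiv) hs (Metric.mem_ball_self hε)
  have h6 := (extChartAt (𝓡 d) (1 : G)).injOn (hb s hs).2 (hb t (Metric.mem_ball_self hε)).2 h5
  exact mul_left_cancel h6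

/-- A locally constant map on a connected set is constant. -/
theorem eq_of_logDer_eq_zero {k : ℝ → G} {U : Set ℝ} (hU : IsOpen U) (hc : IsPreconnected U)
    (h : IsLogPrimitiveOn (0 : ℝ → Eu d) k U) {s t : ℝ} (hs : s ∈ U) (ht : t ∈ U) : k s = k t := by
  have : PreconnectedSpace U := Subtype.preconnectedSpace hc
  have hl : IsLocallyConstant (fun x : U => k x) := by
    refine IsLocallyConstant.iff_eventually_eq _ |>.2 fun x => ?_
    refine continuous_subtype_val.continuousAt.eventually
      (eventually_eq_of_logDer_eq_zero (d := d) ?_)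
    filter_upwards [hU.mem_nhds x.2] with y hy using h y hy
  exact hl.apply_eq_of_isPreconnected isPreconnected_univ (Set.mem_univ (⟨s, hs⟩ : U))
    (Set.mem_univ ⟨t, ht⟩)

theorem IsLogPrimitiveOn.eqOn {ξ : ℝ → Eu d} {g h : ℝ → G} {U : Set ℝ} (hU : IsOpen U)
    (hc : IsPreconnected U) (hg : IsLogPrimitiveOn ξ g U) (hh : IsLogPrimitiveOn ξ h U) {t : ℝ}
    (ht : t ∈ U) (e : g t = h t) : Set.EqOn g h U := by
  -- The order `g h⁻¹` matters: its logarithmic derivative is `Ad(h) ξ - Ad(h) ξ = 0`.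
  have hk : IsLogPrimitiveOn (0 : ℝ → Eu d) (fun s => g s * (h s)⁻¹) U := by
    intro s hs
    refine ⟨(hg s hs).1.mul (hh s hs).1.inv, ?_⟩
    rw [logDer_mul (hg s hs).1 (hh s hs).1.inv, logDer_inv (hh s hs).1, inv_inv]
    simp [(hg s hs).2, (hh s hs).2]
  intro s hs
  have h1 := eq_of_logDer_eq_zero hU hc hk hs ht
  simp only [e, mul_inv_cancel] at h1
  exact mul_inv_eq_one.1 h1

/-! ### Existence of paths with prescribed logarithmic derivative -/

/-- Integral curves of a smooth vector field are smooth. -/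
theorem contDiffOn_of_hasDerivAt {E : Type*} [NormedAddCommGroup E] [NormedSpace ℝ E] {v : E → E}
    {W : Set E} (hv : ContDiffOn ℝ ∞ v W) {α : ℝ → E} {I : Set ℝ} (hI : IsOpen I)
    (hα : ∀ t ∈ I, HasDerivAt α (v (α t)) t) (hW : Set.MapsTo α I W) :
    ContDiffOn ℝ ∞ α I := by
  refine contDiffOn_infty.2 fun n => ?_
  induction n with
  | zero => exact contDiffOn_zero.2 fun t ht => (hα t ht).continuousAt.continuousWithinAt
  | succ n ih =>
    push_cast
    rw [contDiffOn_succ_iff_deriv_of_isOpen hI]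
    refine ⟨fun t ht => (hα t ht).differentiableAt.differentiableWithinAt, by simp, ?_⟩
    -- Bootstrapping: if `α` is of class `Cⁿ`, then so is `α' = v ∘ α`.
    exact ((hv.of_le (mod_cast le_top)).comp ih hW).congr fun t ht => (hα t ht).deriv

/-- A smooth parametrization of a neighbourhood of `1 ∈ G` by `ℝᵈ`. -/
theorem exists_smooth_chart_inverse (d : ℕ) (G : Type*) [TopologicalSpace G]
    [ChartedSpace (Eu d) G] [Group G] [LieGroup (𝓡 d) ∞ G] :
    ∃ (σ : Eu d → G) (z : Eu d), ContMDiff 𝓘(ℝ, Eu d) (𝓡 d) ∞ σ ∧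
      logDer d σ z = ContinuousLinearMap.id ℝ (Eu d) := by
  have : IsManifold (𝓡 d) ∞ G := LieGroup.toContMDiffMul.toIsManifold
  -- Precomposing the inverse chart with a retraction into the chart's target makes it smooth on all
  -- of `ℝᵈ` without changing it near the base point.
  obtain ⟨f, hf, hfu, hfx⟩ := exists_retract (isOpen_extChartAt_target (I := 𝓡 d) (1 : G))
    (mem_extChartAt_target (I := 𝓡 d) (1 : G))
  refine ⟨fun z => (extChartAt (𝓡 d) (1 : G)).symm (f z), extChartAt (𝓡 d) (1 : G) 1, ?_, ?_⟩
  · exact (contMDiffOn_extChartAt_symm (1 : G)).comp_contMDiff hf.contMDiff hfu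
  · have e : (fun z => (extChartAt (𝓡 d) (1 : G)).symm (f z))
        =ᶠ[𝓝 (extChartAt (𝓡 d) (1 : G) 1)] (extChartAt (𝓡 d) (1 : G)).symm := by
      filter_upwards [hfx] with z hz using by rw [hz]
    rw [logDer_congr e, ← mder_chart_symm (G := G)]
    unfold logDer
    simp

/-- On a finite-dimensional space, smoothness of an operator-valued map can be tested on each
vector. -/
theorem contDiff_logDer {W : Type*} [NormedAddCommGroup W] [NormedSpace ℝ W]
    [FiniteDimensional ℝ W] {g : W → G} (hg : ContMDiff 𝓘(ℝ, W) (𝓡 d) ∞ g) :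
    ContDiff ℝ ∞ (logDer d g) := by
  rw [contDiff_clm_apply_iff]
  intro v
  have hF : ContMDiff 𝓘(ℝ, W × W) (𝓡 d) ∞ (fun z : W × W => g z.2) :=
    hg.comp contDiff_snd.contMDiff
  exact contDiff_iff_contDiffAt.2 fun x =>
    contDiffAt_logDer (F := fun z : W × W => g z.2) (a := id) hF contDiffAt_id v

/-- Look for `g = σ ∘ u` with `σ` a parametrization near `1`. The chain rule turns `g⁻¹∂g = ξ` into
`Y(u) u' = ξ(t)`, where `Y = σ⁻¹dσ` is the identity at `z₀` and hence invertible nearby. This is an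
ordinary differential equation in `ℝᵈ`, solvable by Picard-Lindelöf. -/
theorem exists_isLogPrimitiveOn_Ioo_of_pos {ξ : ℝ → Eu d} (hξ : ContDiff ℝ ∞ ξ) (t₀ : ℝ) :
    ∃ ε > 0, ∃ g : ℝ → G, IsLogPrimitiveOn ξ g (Set.Ioo (t₀ - ε) (t₀ + ε)) := by
  obtain ⟨σ, z₀, hσ, hz₀⟩ := exists_smooth_chart_inverse d G
  have hY := contDiff_logDer hσ
  set Y := logDer d σ
  set W : Set (Eu d) := Y ⁻¹' {L | IsUnit L}
  have hWo : IsOpen W := Units.isOpen.preimage hY.continuous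
  have hz₀W : z₀ ∈ W := by
    change IsUnit (Y z₀)
    rw [hz₀]
    exact isUnit_one
  have hX : ContDiffOn ℝ ∞ (fun z => Ring.inverse (Y z)) W := fun z hz => by
    obtain ⟨L, hL⟩ : IsUnit (Y z) := hz
    have h1 := contDiffAt_ringInverse ℝ (n := ∞) L
    rw [hL] at h1
    exact (h1.comp z hY.contDiffAt).contDiffWithinAt
  -- Time is adjoined as a second coordinate with speed `1`, which makes the equation autonomous.
  set v : Eu d × ℝ → Eu d × ℝ := fun q => (Ring.inverse (Y q.1) (ξ q.2), 1)
  have hv : ContDiffOn ℝ ∞ v (W ×ˢ Set.univ) :=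
    ((hX.comp contDiffOn_fst fun q hq => hq.1).clm_apply
      (hξ.comp contDiff_snd).contDiffOn).prodMk contDiffOn_const
  have hvo : IsOpen (W ×ˢ (Set.univ : Set ℝ)) := hWo.prod isOpen_univ
  have hv₀ : ContDiffAt ℝ 1 v (z₀, t₀) :=
    (hv.contDiffAt (hvo.mem_nhds ⟨hz₀W, trivial⟩)).of_le (by simp)
  obtain ⟨α, hα₀, ε, hε, hα⟩ :=
    hv₀.exists_forall_mem_closedBall_exists_eq_forall_mem_Ioo_hasDerivAt₀ t₀
  have hcont : ContinuousAt α t₀ := (hα t₀ ⟨by linarith, by linarith⟩).continuousAt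
  have hnear : ∀ᶠ t in 𝓝 t₀, α t ∈ W ×ˢ (Set.univ : Set ℝ) :=
    hcont.eventually (hvo.mem_nhds (by rw [hα₀]; exact ⟨hz₀W, trivial⟩))
  -- For `|t - t₀| < δ` the integral curve stays where `Y` is invertible; the final radius is `min ε
  -- δ`.
  obtain ⟨δ, hδ, hδW⟩ := Metric.eventually_nhds_iff_ball.1 hnear
  rw [Real.ball_eq_Ioo] at hδW
  have hr : 0 < min ε δ := lt_min hε hδ
  have hI : Set.Ioo (t₀ - min ε δ) (t₀ + min ε δ) ⊆ Set.Ioo (t₀ - ε) (t₀ + ε) :=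
    Set.Ioo_subset_Ioo (by linarith [min_le_left ε δ]) (by linarith [min_le_left ε δ])
  have hI' : Set.Ioo (t₀ - min ε δ) (t₀ + min ε δ) ⊆ Set.Ioo (t₀ - δ) (t₀ + δ) :=
    Set.Ioo_subset_Ioo (by linarith [min_le_right ε δ]) (by linarith [min_le_right ε δ])
  have hsm := contDiffOn_of_hasDerivAt hv isOpen_Ioo (fun t ht => hα t (hI ht))
    (fun t ht => hδW t (hI' ht))
  -- The adjoined coordinate starts at `t₀` and has derivative `1`, so it is the time itself.
  have htime : ∀ t ∈ Set.Ioo (t₀ - min ε δ) (t₀ + min ε δ), (α t).2 = t := by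
    have hd : ∀ t ∈ Set.Ioo (t₀ - min ε δ) (t₀ + min ε δ),
        HasDerivAt (fun t => (α t).2 - t) 0 t := fun t ht => by
      have h1 : HasDerivAt (fun t => (α t).2) 1 t := (hα t (hI ht)).snd
      have h2 := h1.sub (hasDerivAt_id' t)
      rwa [sub_self] at h2
    intro t ht
    have := isOpen_Ioo.is_const_of_deriv_eq_zero isPreconnected_Ioo
      (fun s hs => (hd s hs).differentiableAt.differentiableWithinAt)
      (fun s hs => (hd s hs).deriv) ht (show t₀ ∈ _ from ⟨by linarith, by linarith⟩)
    simp only [hα₀, sub_self] at this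
    exact sub_eq_zero.1 this
  refine ⟨min ε δ, hr, fun t => σ (α t).1, fun t ht => ?_⟩
  have hu : ContDiffAt ℝ ∞ (fun t => (α t).1) t :=
    (hsm.contDiffAt (isOpen_Ioo.mem_nhds ht)).fst
  refine ⟨ContMDiffAt.comp (I' := 𝓘(ℝ, Eu d)) t (hσ _) hu.contMDiffAt, ?_⟩
  have h1 := logDer_comp (d := d) (g := σ) (f := fun t => (α t).1) (x := t) (hσ _)
    (hu.differentiableAt (by simp)) 1
  have h2 : HasDerivAt (fun t => (α t).1) (Ring.inverse (Y (α t).1) (ξ (α t).2)) t :=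
    (hα t (hI ht)).fst
  rw [fderiv_apply_one_eq_deriv, h2.deriv, htime t ht] at h1
  refine h1.trans ?_
  have h3 : Y (α t).1 * Ring.inverse (Y (α t).1) = 1 :=
    Ring.mul_inverse_cancel _ (hδW t (hI' ht)).1
  exact congrArg (fun L : Eu d →L[ℝ] Eu d => L (ξ t)) h3

/-- Solutions of `g⁻¹∂g = ξ` on overlapping intervals can be glued. -/
theorem exists_isLogPrimitiveOn_glue {ξ : ℝ → Eu d} {g h : ℝ → G} {a b a' b' : ℝ}
    (hg : IsLogPrimitiveOn ξ g (Set.Ioo a b)) (hh : IsLogPrimitiveOn ξ h (Set.Ioo a' b'))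
    (haa : a ≤ a') (hab : a' < b) (hbb : b ≤ b') :
    ∃ k : ℝ → G, IsLogPrimitiveOn ξ k (Set.Ioo a b') := by
  obtain ⟨t, ht⟩ := exists_between hab
  have hc := hh.const_mul (g t * (h t)⁻¹)
  have heq : Set.EqOn g (fun s => g t * (h t)⁻¹ * h s) (Set.Ioo a' b) :=
    (hg.mono (Set.Ioo_subset_Ioo_left haa)).eqOn isOpen_Ioo isPreconnected_Ioo
      (hc.mono (Set.Ioo_subset_Ioo_right hbb)) ht (by simp)
  -- The cut at `t` lies inside the overlap, on all of which the two pieces agree. So near any `s <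
  -- b` the new path is `g`, and near any `s ≥ b` it is the translate of `h`.
  refine ⟨fun s => if s < t then g s else g t * (h t)⁻¹ * h s, fun s hs => ?_⟩
  by_cases hsb : s < b
  · have e : (fun s => if s < t then g s else g t * (h t)⁻¹ * h s) =ᶠ[𝓝 s] g := by
      filter_upwards [isOpen_Ioo.mem_nhds (⟨hs.1, hsb⟩ : s ∈ Set.Ioo a b)] with y hy
      split_ifs with hyt
      · rfl
      · exact (heq ⟨ht.1.trans_le (not_lt.1 hyt), hy.2⟩).symm
    rw [logDer_congr e]
    exact ⟨(hg s ⟨hs.1, hsb⟩).1.congr_of_eventuallyEq e, (hg s ⟨hs.1, hsb⟩).2⟩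
  · have hts : t < s := ht.2.trans_le (not_lt.1 hsb)
    have e : (fun s => if s < t then g s else g t * (h t)⁻¹ * h s)
        =ᶠ[𝓝 s] fun s => g t * (h t)⁻¹ * h s := by
      filter_upwards [isOpen_Ioi.mem_nhds hts] with y hy
      rw [if_neg (not_lt.2 (le_of_lt hy))]
    have hs' : s ∈ Set.Ioo a' b' := ⟨ht.1.trans hts, hs.2⟩
    rw [logDer_congr e]
    exact ⟨(hc s hs').1.congr_of_eventuallyEq e, (hc s hs').2⟩

/-- If the right ends reached by solutions from `a` had a finite supremum, a local solution around
the supremum could be glued on and would reach beyond it. -/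
theorem exists_isLogPrimitiveOn_Ioo {ξ : ℝ → Eu d} (hξ : ContDiff ℝ ∞ ξ) (a b : ℝ) :
    ∃ g : ℝ → G, IsLogPrimitiveOn ξ g (Set.Ioo a b) := by
  let S : Set ℝ := {b | ∃ g : ℝ → G, IsLogPrimitiveOn ξ g (Set.Ioo a b)}
  have hS : ∀ x ∈ S, ∀ y ≤ x, y ∈ S := fun x ⟨g, hg⟩ y hy =>
    ⟨g, hg.mono (Set.Ioo_subset_Ioo_right hy)⟩
  obtain ⟨ε, hε, g, hg⟩ := exists_isLogPrimitiveOn_Ioo_of_pos (G := G) hξ a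
  have ha : a + ε ∈ S := ⟨g, hg.mono (Set.Ioo_subset_Ioo_left (by linarith))⟩
  by_cases hb : BddAbove S
  · exfalso
    obtain ⟨δ, hδ, h, hh⟩ := exists_isLogPrimitiveOn_Ioo_of_pos (G := G) hξ (sSup S)
    have h1 : a + ε ≤ sSup S := le_csSup hb ha
    -- Gluing requires the left end of the second interval to be at least `a` and less than `c`;
    -- this is why the local solution is cut off at `max a (sSup S - δ)`.
    obtain ⟨c, ⟨k, hk⟩, hc⟩ := exists_lt_of_lt_csSup ⟨_, ha⟩
      (show max a (sSup S - δ) < sSup S from max_lt (by linarith) (by linarith))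
    have h2 : c ≤ sSup S := le_csSup hb ⟨k, hk⟩
    have h3 : sSup S + δ ∈ S := exists_isLogPrimitiveOn_glue hk
      (hh.mono (Set.Ioo_subset_Ioo_left (le_max_right a _))) (le_max_left _ _) hc (by linarith)
    linarith [le_csSup hb h3]
  · obtain ⟨c, hc, hbc⟩ := not_bddAbove_iff.1 hb b
    exact hS c hc b hbc.le

/-- On a Lie group, `g⁻¹∂g = ξ` has a global solution with `g(0) = 1`. -/
theorem exists_isLogPrimitiveOn_univ {ξ : ℝ → Eu d} (hξ : ContDiff ℝ ∞ ξ) :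
    ∃ g : ℝ → G, g 0 = 1 ∧ IsLogPrimitiveOn ξ g Set.univ := by
  have h : ∀ r : ℝ, ∃ g : ℝ → G, g 0 = 1 ∧ IsLogPrimitiveOn ξ g (Set.Ioo (-r) r) := fun r => by
    obtain ⟨g, hg⟩ := exists_isLogPrimitiveOn_Ioo (G := G) hξ (-r) r
    exact ⟨fun t => (g 0)⁻¹ * g t, by simp, hg.const_mul _⟩
  choose g h0 hg using h
  have heq : ∀ {r s : ℝ}, 0 < r → r ≤ s → Set.EqOn (g r) (g s) (Set.Ioo (-r) r) :=
    fun {r s} hr hrs => (hg r).eqOn isOpen_Ioo isPreconnected_Ioo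
      ((hg s).mono (Set.Ioo_subset_Ioo (by linarith) hrs)) (t := 0) ⟨by linarith, hr⟩
      (by rw [h0, h0])
  -- The solutions on the intervals `(-r, r)` are nested by uniqueness. The index `|t| + 1` puts `t`
  -- inside its interval, and for `y` near `t` all the indices `|y| + 1` are below `|t| + 2`, so
  -- near `t` the path is the single solution with that index.
  refine ⟨fun t => g (|t| + 1) t, h0 _, fun t _ => ?_⟩
  have e : (fun t => g (|t| + 1) t) =ᶠ[𝓝 t] g (|t| + 2) := by
    have hn : ∀ᶠ y in 𝓝 t, |y| < |t| + 1 :=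
      continuous_abs.continuousAt.eventually_lt_const (by linarith)
    filter_upwards [hn] with y hy
    exact heq (by positivity) (by linarith) (abs_lt.1 (by linarith))
  have ht : t ∈ Set.Ioo (-(|t| + 2)) (|t| + 2) := abs_lt.1 (by linarith)
  rw [logDer_congr e]
  exact ⟨(hg _ t ht).1.congr_of_eventuallyEq e, (hg _ t ht).2⟩

end LogPrimitive

end Caloron

namespace Caloron

/-! ### Uniqueness of horizontal lifts -/

namespace PrincipalBundle

variable {𝒢 P X : Type*} [Group 𝒢] [DiffeologicalSpace 𝒢] [DiffeologicalSpace P]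
  [DiffeologicalSpace X] (B : PrincipalBundle 𝒢 P X)

theorem act_div {p q : P} (h : B.proj p = B.proj q) : B.act p (B.div p q) = q := by
  have h1 := B.exists_act_eq h
  unfold div
  rw [dif_pos h1]
  exact h1.choose_spec.symm

/-- The action is free, so the chosen quotient is the only one. -/
theorem div_eq {p q : P} {g : 𝒢} (h : q = B.act p g) : B.div p q = g := by
  refine B.act_injective (p := p) ?_
  rw [B.act_div (by rw [h, B.proj_act]), h]

end PrincipalBundle

/-! ### Curves as plots on `ℝ¹` -/

section Curves

theorem contDiff_eval_zero : ContDiff ℝ ∞ (fun x : Eu 1 => x 0) := by fun_prop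

theorem contDiff_single_zero : ContDiff ℝ ∞ (fun t : ℝ => (EuclideanSpace.single 0 t : Eu 1)) := by
  have e : (fun t : ℝ => (EuclideanSpace.single 0 t : Eu 1))
      = fun t : ℝ => t • (EuclideanSpace.single 0 1 : Eu 1) := by
    ext t i
    simp
  rw [e]
  fun_prop

theorem fderiv_eval_zero (x : Eu 1) :
    fderiv ℝ (fun x : Eu 1 => x 0) x (EuclideanSpace.single 0 1) = 1 := by
  have h : HasFDerivAt (fun x : Eu 1 => x 0) (EuclideanSpace.proj (0 : Fin 1) : Eu 1 →L[ℝ] ℝ) x :=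
    (EuclideanSpace.proj (0 : Fin 1) : Eu 1 →L[ℝ] ℝ).hasFDerivAt
  rw [h.fderiv]
  simp

theorem contMDiff_of_isPlot {d : ℕ} {G : Type*} [TopologicalSpace G] [ChartedSpace (Eu d) G]
    {k : ℝ → G} (hk : IsPlot (fun x : Eu 1 => k (x 0))) :
    ContMDiff 𝓘(ℝ, ℝ) (𝓡 d) ∞ k := by
  have h : ContMDiff 𝓘(ℝ, Eu 1) (𝓡 d) ∞ (fun x : Eu 1 => k (x 0)) := fun x => hk x
  have e : k = (fun x : Eu 1 => k (x 0)) ∘ fun t : ℝ => (EuclideanSpace.single 0 t : Eu 1) := by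
    ext t
    simp
  rw [e]
  exact h.comp contDiff_single_zero.contMDiff

end Curves

/-! ### Quotients of lifts and uniqueness -/

section HorizontalLift

variable {d : ℕ} {G : Type*} [TopologicalSpace G] [ChartedSpace (Eu d) G] [Group G]
  [LieGroup (𝓡 d) ∞ G] {Q X M : Type*} [DiffeologicalSpace Q] [DiffeologicalSpace X]
  [DiffeologicalSpace M]

/-- In a local trivialization `p = s φ(p)` and `q = s φ(q)` over the same base point, so the
quotient is `φ(p)⁻¹ φ(q)`. -/
theorem PrincipalBundle.isPlot_div (B : PrincipalBundle G Q X) {n : ℕ} {p q : Eu n → Q}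
    (hp : IsPlot p) (hq : IsPlot q) (h : ∀ y, B.proj (p y) = B.proj (q y)) :
    IsPlot (fun y => B.div (p y) (q y)) := by
  refine isPlot_of_locally fun x => ?_
  obtain ⟨U, s, φ, hU, hx, h1, h2, h3, h4, h5⟩ := B.locally_trivial (B.proj (p x))
  have ho : IsOpen ((fun y => B.proj (p y)) ⁻¹' U) :=
    isOpen_iff_preimages_plots.1 hU n _ (B.smooth_proj n p hp)
  -- The map `φ` is smooth only on plots lying entirely over `U`, so the plots are first retracted
  -- into the preimage of `U`.
  obtain ⟨f, hf, hfu, hfx⟩ := exists_retract ho hx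
  have hp' : IsPlot (fun y => φ (p (f y))) := h5 _ (isPlot_reparam hp hf) fun z => hfu z
  have hq' : IsPlot (fun y => φ (q (f y))) := h5 _ (isPlot_reparam hq hf) fun z => by
    rw [← h]; exact hfu z
  refine ⟨fun y => (φ (p (f y)))⁻¹ * φ (q (f y)), fun y => (hp' y).inv.mul (hq' y), ?_⟩
  filter_upwards [hfx] with y hy
  have hyU : B.proj (p y) ∈ U := by have := hfu y; rwa [hy] at this
  refine B.div_eq ?_
  rw [hy]
  have h6 := h2 (p y) hyU
  have h7 := h2 (q y) (h y ▸ hyU)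
  rw [← h] at h7
  calc q y = B.act (B.act (s (B.proj (p y))) (φ (p y))) ((φ (p y))⁻¹ * φ (q y)) := by
        rw [← B.act_mul, mul_inv_cancel_left, h7]
    _ = _ := by rw [h6]

theorem logDer_comp_eval_zero {k : ℝ → G} (hk : ContMDiff 𝓘(ℝ, ℝ) (𝓡 d) ∞ k) (t : ℝ) :
    logDer d (fun x : Eu 1 => k (x 0)) (EuclideanSpace.single 0 t) (EuclideanSpace.single 0 1)
      = logDer d k t 1 := by
  have h := logDer_comp (d := d) (g := k) (f := fun x : Eu 1 => x 0)
    (x := EuclideanSpace.single 0 t) (hk _)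
    (contDiff_eval_zero.contDiffAt.differentiableAt (by simp)) (EuclideanSpace.single 0 1)
  rw [fderiv_eval_zero] at h
  simp only [PiLp.single_eq_same] at h
  exact h

/-- Horizontal lifts with a given initial point are unique. -/
theorem IsHorizontalLift.unique {B : PrincipalBundle G Q (M × Real.Angle)} {s : Framing B}
    {A : GConnection d B} {γ : BaseLoops M} {c c' : ℝ → Q} (h : IsHorizontalLift s A γ c)
    (h' : IsHorizontalLift s A γ c') : c' = c := by
  obtain ⟨h0, hp, hc, hh⟩ := h
  obtain ⟨h0', hp', hc', hh'⟩ := h'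
  have hpp : ∀ t, B.proj (c t) = B.proj (c' t) := fun t => by rw [hp, hp']
  set k : ℝ → G := fun t => B.div (c t) (c' t)
  have hk : ∀ t, B.act (c t) (k t) = c' t := fun t => B.act_div (hpp t)
  have hcp : IsPlot (fun x : Eu 1 => c (x 0)) := hc 1 (fun x => x 0) contDiff_eval_zero.isPlot
  have hcp' : IsPlot (fun x : Eu 1 => c' (x 0)) := hc' 1 (fun x => x 0) contDiff_eval_zero.isPlot
  have hkp : IsPlot (fun x : Eu 1 => k (x 0)) := B.isPlot_div hcp hcp' fun y => hpp _
  have hks : ContMDiff 𝓘(ℝ, ℝ) (𝓡 d) ∞ k := contMDiff_of_isPlot hkp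
  have hkd : IsLogPrimitiveOn (0 : ℝ → Eu d) k Set.univ := by
    refine fun t _ => ⟨hks t, ?_⟩
    -- The rule `A(∂(c k)) = Ad(k⁻¹) A(∂c) + k⁻¹∂k`: as `c` and `c' = c k` are both horizontal, only
    -- `k⁻¹∂k = 0` remains.
    have h1 := A.toFun_act _ hcp _ hkp (EuclideanSpace.single 0 t) (EuclideanSpace.single 0 1)
    have h2 : A.form.toFun (fun x : Eu 1 => c (x 0)) hcp (EuclideanSpace.single 0 t)
      (EuclideanSpace.single 0 1) = 0 := hh t
    have h3 : A.form.toFun (fun x : Eu 1 => c' (x 0)) hcp' (EuclideanSpace.single 0 t)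
      (EuclideanSpace.single 0 1) = 0 := hh' t
    simp only [hk] at h1
    rw [h2, h3, map_zero, zero_add] at h1
    rw [← logDer_comp_eval_zero hks]
    exact h1.symm
  ext t
  have h1 : k t = k 0 :=
    eq_of_logDer_eq_zero isOpen_univ isPreconnected_univ hkd (Set.mem_univ t) (Set.mem_univ 0)
  have h2 : k 0 = 1 := B.div_eq (by rw [B.act_one, h0, h0'])
  rw [← hk t, h1, h2, B.act_one]

theorem horizontalLift_eq {B : PrincipalBundle G Q (M × Real.Angle)} {s : Framing B}
    {A : GConnection d B} {γ : BaseLoops M} {c : ℝ → Q} (h : IsHorizontalLift s A γ c) :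
    horizontalLift s A γ = c := by
  have h1 : ∃ c, IsHorizontalLift s A γ c := ⟨c, h⟩
  unfold horizontalLift
  rw [dif_pos h1]
  exact h.unique h1.choose_spec

end HorizontalLift

/-! ### The Higgs field holonomy -/

section HiggsHolonomy

variable {d : ℕ} {G : Type*} [TopologicalSpace G] [ChartedSpace (Eu d) G] [Group G]
  [LieGroup (𝓡 d) ∞ G] {P M : Type*} [DiffeologicalSpace P] [DiffeologicalSpace M]
  {B : PrincipalBundle (LoopGroup d G) P M}

/-- The periodicity of `g⁻¹∂g` required in `PathSpace` is that of `Φ(p)`, a function on the circle.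
-/
theorem HiggsField.exists_isSolution (Φ : HiggsField B) (p : P) : ∃ g, Φ.IsSolution p g := by
  obtain ⟨g, h0, hg⟩ := exists_isLogPrimitiveOn_univ (G := G)
    (ξ := fun t : ℝ => (Φ.toFun p : Real.Angle → Eu d) t) (Φ.toFun p).2
  refine ⟨⟨g, fun t => (hg t trivial).1, h0, fun t => ?_⟩, fun t => (hg t trivial).2⟩
  rw [(hg _ trivial).2, (hg _ trivial).2]
  simp

theorem HiggsField.IsSolution.unique {Φ : HiggsField B} {p : P} {g h : PathSpace d G}
    (hg : Φ.IsSolution p g) (hh : Φ.IsSolution p h) : g = h := by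
  ext t
  exact IsLogPrimitiveOn.eqOn (ξ := fun t : ℝ => (Φ.toFun p : Real.Angle → Eu d) t) isOpen_univ
    isPreconnected_univ (fun s _ => ⟨g.smooth s, hg s⟩) (fun s _ => ⟨h.smooth s, hh s⟩)
    (Set.mem_univ 0) (by rw [g.map_zero, h.map_zero]) (Set.mem_univ t)

theorem HiggsField.isSolution_holPath (Φ : HiggsField B) (p : P) :
    Φ.IsSolution p (Φ.holPath p) := by
  unfold HiggsField.holPath
  rw [dif_pos (Φ.exists_isSolution p)]
  exact (Φ.exists_isSolution p).choose_spec

theorem LoopGroup.logDer_coe (γ : LoopGroup d G) (t : ℝ) :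
    logDer d (fun s : ℝ => γ s) t 1 = γ.logDeriv t := by
  have h1 := logDer_comp (d := d) (V := ℝ) (g := fun s : ℝ => γ (s : Real.Angle))
    (f := fun s : ℝ => t + s) (x := 0) (γ.smooth _) (by fun_prop) 1
  have h2 : HasDerivAt (fun s : ℝ => t + s) 1 0 := (hasDerivAt_id 0).const_add _
  rw [fderiv_apply_one_eq_deriv, h2.deriv, add_zero] at h1
  rw [← h1]
  unfold LoopGroup.logDeriv
  congr 2

/-- `hol_Φ(p γ) = hol_Φ(p) γ`. -/
theorem HiggsField.holPath_act (Φ : HiggsField B) (p : P) (γ : LoopGroup d G) (t : ℝ) :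
    (Φ.holPath (B.act p γ)).toFun t = (Φ.holPath p).toFun t * γ t := by
  have hs := Φ.isSolution_holPath p
  set g := Φ.holPath p
  -- The product rule gives `Ad(γ⁻¹) Φ(p) + γ⁻¹∂γ`, which is `Φ(pγ)` by the equivariance of the
  -- Higgs field.
  have hd : ∀ t : ℝ, logDer d (fun t => g.toFun t * γ t) t 1
      = (Φ.toFun (B.act p γ) : Real.Angle → Eu d) t := fun t => by
    have h1 := logDer_mul (g.smooth t) (γ.smooth t)
    rw [h1, Φ.equivariant, ← LoopGroup.logDer_coe, ← hs t]
    rfl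
  have h2 : Φ.IsSolution (B.act p γ) ⟨fun t => g.toFun t * γ t, g.smooth.mul γ.smooth, by
      simp [g.map_zero, γ.map_zero], fun t => by rw [hd, hd]; simp⟩ := hd
  rw [(Φ.isSolution_holPath (B.act p γ)).unique h2]

/-- The chosen point over `π(p)` is some `pγ`, and `γ` takes the value `1` at `2π = 0` in the
circle. -/
theorem HiggsField.hol_proj (Φ : HiggsField B) (p : P) :
    Φ.hol (B.proj p) = (Φ.holPath p).toFun (2 * Real.pi) := by
  obtain ⟨γ, hγ⟩ := B.exists_act_eq (p := p) (q := Function.surjInv B.proj_surjective (B.proj p))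
    (Function.surjInv_eq B.proj_surjective _).symm
  unfold HiggsField.hol
  rw [hγ, Φ.holPath_act, Real.Angle.coe_two_pi, γ.map_zero, mul_one]

/-- The horizontal lift of `η(π(p))` is `t ↦ [p, hol_Φ(p)(t)⁻¹, t]`. -/
theorem isHorizontalLift_eta (A : LoopConnection B) (Φ : HiggsField B) (p : P) :
    IsHorizontalLift (caloronFraming B) (caloronConnection A Φ) (eta (B.proj p))
      (fun t : ℝ => caloronMk B (p, ((Φ.holPath p).toFun t)⁻¹, (t : Real.Angle))) := by
  have hs := Φ.isSolution_holPath p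
  set g := Φ.holPath p
  have hplot : ∀ {n : ℕ} {q : Eu n → ℝ}, ContDiff ℝ ∞ q →
      IsPlot (fun y => (p, (g.toFun (q y))⁻¹, (q y : Real.Angle))) := fun {n q} hq =>
    ⟨isPlot_const, fun y => (g.smooth.comp hq.contMDiff).inv y,
      fun _ => ⟨q, hq.isPlot, Filter.EventuallyEq.rfl⟩⟩
  have hc : DSmooth (fun t : ℝ => caloronMk B (p, (g.toFun t)⁻¹, (t : Real.Angle))) :=
    fun n q hq => isPlot_caloronMk B (hplot hq.contDiff)
  refine ⟨?_, fun t => rfl, hc, fun t => ?_⟩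
  · change caloronMk B (p, (g.toFun 0)⁻¹, ((0 : ℝ) : Real.Angle)) = (caloronFraming B).sec (B.proj p)
    rw [caloronFraming_proj, g.map_zero, inv_one, Real.Angle.coe_zero]
  · have h1 := caloronForm_toFun A Φ
      (fun x : Eu 1 => caloronMk B (p, (g.toFun (x 0))⁻¹, (x 0 : Real.Angle)))
      (isPlot_caloronMk B (hplot contDiff_eval_zero)) _ (hplot contDiff_eval_zero)
      (EuclideanSpace.single 0 t) Filter.EventuallyEq.rfl
    refine (congrArg (fun L => L (EuclideanSpace.single 0 1)) h1).trans ?_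
    have h2 : dAngle (fun x : Eu 1 => (x 0 : Real.Angle)) (EuclideanSpace.single 0 t)
        (EuclideanSpace.single 0 1) = 1 := by
      rw [dAngle_eq Filter.EventuallyEq.rfl contDiff_eval_zero.continuous.continuousAt,
        fderiv_eval_zero]
    have h3 : logDer d (fun x : Eu 1 => (g.toFun (x 0))⁻¹) (EuclideanSpace.single 0 t)
        (EuclideanSpace.single 0 1)
        = -Ad d (g.toFun t) ((Φ.toFun p : Real.Angle → Eu d) t) := by
      rw [logDer_comp_eval_zero (k := fun t => (g.toFun t)⁻¹) g.smooth.inv t,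
        logDer_inv (g.smooth t), ← hs t]
      rfl
    -- The three terms of `Ã` on the velocity of `(p, g⁻¹, t)`: the first vanishes as `p` is
    -- constant, and the other two are `-Ad(g) Φ(p)` and `Ad(g) Φ(p)`.
    change Ad d ((g.toFun ((EuclideanSpace.single 0 t : Eu 1) 0))⁻¹)⁻¹
        ((A.form.toFun (fun _ : Eu 1 => p) isPlot_const (EuclideanSpace.single 0 t)
          (EuclideanSpace.single 0 1) : Real.Angle → Eu d)
          (((EuclideanSpace.single 0 t : Eu 1) 0 : ℝ) : Real.Angle))
      + logDer d (fun x : Eu 1 => (g.toFun (x 0))⁻¹) (EuclideanSpace.single 0 t)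
        (EuclideanSpace.single 0 1)
      + dAngle (fun x : Eu 1 => (x 0 : Real.Angle)) (EuclideanSpace.single 0 t)
        (EuclideanSpace.single 0 1) • Ad d ((g.toFun ((EuclideanSpace.single 0 t : Eu 1) 0))⁻¹)⁻¹
        ((Φ.toFun p : Real.Angle → Eu d) (((EuclideanSpace.single 0 t : Eu 1) 0 : ℝ) : Real.Angle))
      = 0
    rw [A.form.toFun_const, h2, h3]
    simp

/-- `η̂(p)(t) = η(π(p))_h(t) hol_Φ(p)(t)`. -/
theorem div_horizontalLift_eta (A : LoopConnection B) (Φ : HiggsField B) (p : P) (t : ℝ) :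
    (caloronTransform B).div (horizontalLift (caloronFraming B) (caloronConnection A Φ)
      (eta (B.proj p)) t) (caloronMk B (p, 1, (t : Real.Angle))) = (Φ.holPath p).toFun t := by
  rw [horizontalLift_eq (isHorizontalLift_eta A Φ p)]
  refine (caloronTransform B).div_eq ?_
  change _ = caloronMk B (p, ((Φ.holPath p).toFun t)⁻¹ * (Φ.holPath p).toFun t, (t : Real.Angle))
  rw [inv_mul_cancel]

end HiggsHolonomy

end Caloron

/-! ### Comparison of the Higgs field holonomy with the holonomy of the caloron transform -/

theorem lemmaL (d : ℕ) {G : Type*} [TopologicalSpace G] [T2Space G] [ChartedSpace (Caloron.Eu d) G]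
    [Group G] [LieGroup (𝓡 d) ∞ G] {P M : Type*} [DiffeologicalSpace P] [DiffeologicalSpace M]
    (B : Caloron.PrincipalBundle (Caloron.LoopGroup d G) P M)
    (A : Caloron.LoopConnection B) (Φ : Caloron.HiggsField B) :
    (∀ p : P, ∃! g : Caloron.PathSpace d G, Φ.IsSolution p g) ∧
    (∀ m : M, ∃! c : ℝ → Caloron.CaloronSpace B, Caloron.IsHorizontalLift
      (Caloron.caloronFraming B) (Caloron.caloronConnection A Φ) (Caloron.eta m) c) ∧
    (∀ p : P, Φ.hol (B.proj p) = (Φ.holPath p).toFun (2 * Real.pi)) ∧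
    (∀ p : P, (Φ.holPath p).toFun = Caloron.holPath (Caloron.caloronFraming B)
      (Caloron.caloronConnection A Φ) (Caloron.etaHat B p)) ∧
    Φ.hol = Caloron.hol (Caloron.caloronFraming B) (Caloron.caloronConnection A Φ) ∘ Caloron.eta := by
  refine ⟨fun p => ?_, fun m => ?_, Φ.hol_proj, fun p => ?_, ?_⟩
  · obtain ⟨g, hg⟩ := Φ.exists_isSolution p
    exact ⟨g, hg, fun h hh => hh.unique hg⟩
  · obtain ⟨p, rfl⟩ := B.proj_surjective m
    exact ⟨_, Caloron.isHorizontalLift_eta A Φ p,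
      fun c hc => (Caloron.isHorizontalLift_eta A Φ p).unique hc⟩
  · funext t
    exact (Caloron.div_horizontalLift_eta A Φ p t).symm
  · funext m
    obtain ⟨p, rfl⟩ := B.proj_surjective m
    -- At `t = 2π` the point `[p, 1, t]` is `[p, 1, 0] = s₀(π(p), 0)`, so the quotient by the
    -- horizontal lift is the one that defines `hol`.
    rw [Φ.hol_proj, ← Caloron.div_horizontalLift_eta A Φ p, Real.Angle.coe_two_pi,
      ← Caloron.caloronFraming_proj]
    rfl
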